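/- **Setting.** An output port is a server of constant rate $C>0$ serving finitely many traffic classes, one queue per class, under the non-preemptive static-priority policy (work-conserving, one frame at a time; when a frame transmission starts, the selected class has the highest current priority among the backlogged classes; a smaller number means a higher priority). Class $j$ has maximum frame size $MFS_j$ and its input is constrained by the leaky-bucket arrival curve $\alpha_j(t)=b_j+r_jt$ with $b_j,r_j\ge 0$. It has a high priority $p_H(j)$ and a low priority $p_L(j)\ge p_H(j)$; different classes have no priority level in common. If $p_L(j)>p_H(j)$, class $j$ is shaped by a Burst Limiting Shaper ($j\in BLS$); otherwise $j\in NBLS$ and $p(j):=p_H(j)=p_L(j)$. A class $j\in BLS$ has thresholds $0\le L_R^j<L_M^j$, a reserved bandwidth $0<BW^j<1$, and slopes $I_{idle}^j=BW^jC$, $I_{send}^j=C-I_{idle}^j$. Its credit is continuous, starts at $0$, increases with slope $I_{send}^j$ while a class-$j$ frame is transmitted (staying at $L_M^j$ once this level is reached), and otherwise decreases with slope $-I_{idle}^j$ (staying at $0$ once this level is reached). The priority of class $j$ is initially $p_H(j)$; it becomes $p_L(j)$ when it is high and the credit reaches $L_M^j$, and $p_H(j)$ when it is low and the credit reaches $L_R^j$.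 Let $R_i$ and $R_i^*$ be the cumulative input and output of class $i$. A function $\beta$ is a strict minimum service curve for an input $R$ and output $R^*$ if $R^*(t)-R^*(s)\ge\beta(t-s)$ for every backlogged period $]s,t]$, i.e. whenever $R(\tau)-R^*(\tau)>0$ for all $\tau\in\,]s,t]$. Write $(f\oslash g)(t)=\sup_{s\ge 0}\{f(t+s)-g(s)\}$ (possibly $+\infty$) and $g_\uparrow(t)=\max\{0,\sup_{0\le s\le t}g(s)\}$. For $j\in BLS$ let $HC(j)$ be the set of classes $i$ with $p_H(i)<p_H(j)$, let $MC(j)$ be the set of classes having at least one of their priorities strictly between $p_H(j)$ and $p_L(j)$, let $M_j=\max_{i\in MC(j)}MFS_i$ ($0$ if $MC(j)=\emptyset$), and put $$\beta_j^{bls}(t)=\Big(C-\sum_{h\in HC(j)}r_h-\frac{MFS_j^{sat}}{\Delta_{inter}^{j,\beta}}\Big)\frac{I_{idle}^j}{C}\,\big(t-\Delta_{idle}^{j,\beta}\big)^+,$$ where $$MFS_j^{sat}=\max\Big(M_j-\frac{C}{I_{idle}^j}L_R^j,0\Big),\qquad L_R^{j,min}=\max\Big(L_R^j-\frac{M_j}{C}I_{idle}^j,0\Big),$$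 $$\Delta_{inter}^{j,\beta}=\frac{L_M^j-L_R^{j,min}}{I_{send}^j}+\frac{L_M^j-L_R^j}{I_{idle}^j}+\frac{M_j}{C},\qquad \Delta_{idle}^{j,\beta}=\frac{L_M^j-L_R^j}{I_{idle}^j}+\frac{M_j}{C}.$$ Let also $$b_j^{max}=\frac{C}{I_{send}^j}L_M^j+MFS_j,\quad \Delta_{send}^{j,\gamma}=\frac{MFS_j}{C}+\frac{L_M^j-L_R^j}{I_{send}^j},\quad \Delta_{idle}^{j,\gamma}=\frac{L_M^j-L_R^j}{I_{idle}^j},\quad \Delta_{inter}^{j,\gamma}=\Delta_{send}^{j,\gamma}+\Delta_{idle}^{j,\gamma}.$$ For a class $k$, the maximum service curve of $j$ that applies during a backlogged period of $k$ is $$\gamma_j^{bls}(t)=\frac{\Delta_{send}^{j,\gamma}}{\Delta_{inter}^{j,\gamma}}\,C\,t+b_j^{max}\,\frac{\Delta_{idle}^{j,\gamma}}{\Delta_{inter}^{j,\gamma}}\ \text{ if } k\in MC(j)\text{ (so that } MC(j)\text{ is backlogged)},\qquad \gamma_j^{bls}(t)=C\,t\ \text{ otherwise.}$$ **Theorem.**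 Let $\beta$ be a strict minimum service curve offered by the port to the aggregate of all classes, and let $k\in NBLS$. Then $$\beta_k^{mux}(t)=\max\big(\beta_k^{sp}(t),\beta_k^{bls}(t)\big)$$ is a strict minimum service curve offered by the port to class $k$, where $$\beta_k^{sp}=\Big(\beta-\sum_{j\in BLS,\;p_H(j)<p(k)}\alpha_j\oslash\beta_j^{bls}-\sum_{j\in NBLS,\;p(j)<p(k)}\alpha_j-\max_{j:\;p_L(j)\ge p(k)}MFS_j\Big)_\uparrow,$$ $$\beta_k^{bls}=\Big(\beta-\sum_{j\in BLS,\;p_H(j)<p(k)}\gamma_j^{bls}-\sum_{j\in NBLS,\;p(j)<p(k)}\alpha_j-\max_{j:\;p_L(j)\ge p(k)}MFS_j\Big)_\uparrow .$$ -/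

import Mathlib

open Set Filter Topology

noncomputable section

/-! ### Network calculus (curves are extended-real valued functions of a duration) -/

namespace NetCalc

/-- Min-plus convolution `(f ⊗ g)(t) = inf_{0 ≤ s ≤ t} (f (t - s) + g s)`. -/
def conv (f g : ℝ → ℝ) (t : ℝ) : EReal :=
  ⨅ s ∈ Icc (0 : ℝ) t, ((f (t - s) + g s : ℝ) : EReal)

/-- Min-plus deconvolution `(f ⊘ g)(t) = sup_{s ≥ 0} (f (t + s) - g s)`, possibly `+∞`. -/
def deconv (f g : ℝ → ℝ) (t : ℝ) : EReal :=
  ⨆ s ∈ Ici (0 : ℝ), ((f (t + s) - g s : ℝ) : EReal)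

/-- `g_↑(t) = max (0, sup_{0 ≤ s ≤ t} g s)`. -/
def upClosure (g : ℝ → EReal) (t : ℝ) : EReal :=
  max 0 (⨆ s ∈ Icc (0 : ℝ) t, g s)

/-- `α` is an arrival curve of the input cumulative function `R`: `R ≤ R ⊗ α`. -/
def IsArrivalCurve (R α : ℝ → ℝ) : Prop :=
  ∀ t, 0 ≤ t → (R t : EReal) ≤ conv R α t

/-- `β` is a strict minimum service curve for the input `A` and the output `D`:
`D t - D s ≥ β (t - s)` for every backlogged period `]s, t]`. -/
def IsStrictServiceCurve (A D : ℝ → ℝ) (β : ℝ → EReal) : Prop :=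
  ∀ s t, 0 ≤ s → s ≤ t → (∀ τ ∈ Ioc s t, 0 < A τ - D τ) →
    β (t - s) ≤ ((D t - D s : ℝ) : EReal)

end NetCalc

/-- Configuration of an output port: link speed, traffic classes (one queue per class) and the
parameters of the burst limiting shapers. Priority `0` is the highest priority. -/
structure PortConfig (ι : Type*) where
  /-- link speed -/
  C : ℝ
  C_pos : 0 < C
  /-- high priority level of a class -/
  pH : ι → ℕ
  /-- low priority level of a class; the shaper of the class is active iff `pH i < pL i` -/
  pL : ι → ℕ
  pH_le_pL : ∀ i, pH i ≤ pL i
  /-- no two classes share a priority level -/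
  level_ne : ∀ i j, i ≠ j → pH i ≠ pH j ∧ pH i ≠ pL j ∧ pL i ≠ pL j
  /-- maximum frame size -/
  mfs : ι → ℝ
  mfs_nonneg : ∀ i, 0 ≤ mfs i
  /-- burst of the arrival curve -/
  b : ι → ℝ
  b_nonneg : ∀ i, 0 ≤ b i
  /-- rate of the arrival curve -/
  r : ι → ℝ
  r_nonneg : ∀ i, 0 ≤ r i
  /-- reserved bandwidth, a fraction of the link speed -/
  BW : ι → ℝ
  BW_pos : ∀ i, pH i < pL i → 0 < BW i
  BW_lt_one : ∀ i, pH i < pL i → BW i < 1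
  /-- resume level of the credit -/
  LR : ι → ℝ
  /-- maximum level of the credit -/
  LM : ι → ℝ
  LR_nonneg : ∀ i, pH i < pL i → 0 ≤ LR i
  LR_lt_LM : ∀ i, pH i < pL i → LR i < LM i

namespace PortConfig

variable {ι : Type*} (P : PortConfig ι)

/-- The class is shaped by a BLS. -/
def IsBLS (i : ι) : Prop := P.pH i < P.pL i

/-- Decreasing slope of the credit. -/
def Iidle (i : ι) : ℝ := P.BW i * P.C

/-- Increasing slope of the credit. -/
def Isend (i : ι) : ℝ := P.C - P.Iidle i

/-- Leaky-bucket arrival curve of a class. -/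
def alpha (i : ι) (t : ℝ) : ℝ := P.b i + P.r i * t

/-- Classes that can have a priority strictly higher than the high priority of class `j`. -/
def HC (j : ι) : Set ι := {i | P.pH i < P.pH j}

/-- Classes that can have a priority strictly between the two priorities of class `j`
(a BLS class belongs to it as soon as one of its two levels lies in between). -/
def MC (j : ι) : Set ι :=
  {i | (P.pH j < P.pH i ∧ P.pH i < P.pL j) ∨ (P.pH j < P.pL i ∧ P.pL i < P.pL j)}

/-- Classes that can have a priority lower than or equal to the (high) priority of class `k`. -/
def notHigher (k : ι) : Set ι := {i | P.pH k ≤ P.pL i}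

/-- Maximum frame size over a set of classes (`0` for the empty set). -/
def maxMFS (S : Set ι) : ℝ := ⨆ i : S, P.mfs i

/-! #### Minimum and maximum service curves of the BLS of class `j` -/

def mfsSat (j : ι) : ℝ := max (P.maxMFS (P.MC j) - P.C / P.Iidle j * P.LR j) 0

def LRmin (j : ι) : ℝ := max (P.LR j - P.maxMFS (P.MC j) / P.C * P.Iidle j) 0

def betaInter (j : ι) : ℝ :=
  (P.LM j - P.LRmin j) / P.Isend j + (P.LM j - P.LR j) / P.Iidle j + P.maxMFS (P.MC j) / P.C

def betaIdle (j : ι) : ℝ := (P.LM j - P.LR j) / P.Iidle j + P.maxMFS (P.MC j) / P.C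

open Classical in
/-- Minimum service curve `β_j^{bls}`. -/
def betaBLS [Fintype ι] (j : ι) (t : ℝ) : ℝ :=
  (P.C - ∑ h with h ∈ P.HC j, P.r h - P.mfsSat j / P.betaInter j) * (P.Iidle j / P.C) *
    max (t - P.betaIdle j) 0

def burstMax (j : ι) : ℝ := P.C / P.Isend j * P.LM j + P.mfs j

def gammaSend (j : ι) : ℝ := P.mfs j / P.C + (P.LM j - P.LR j) / P.Isend j

def gammaIdle (j : ι) : ℝ := (P.LM j - P.LR j) / P.Iidle j

def gammaInter (j : ι) : ℝ := P.gammaSend j + P.gammaIdle j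

open Classical in
/-- Maximum service curve `γ_j^{bls}` during a backlogged period of class `k`. When `k ∈ MC(j)`,
this is a backlogged period of `MC(j)` and the leaky-bucket curve applies; otherwise `MC(j)` may
be without backlog, and the curve is `C t`. -/
def gammaBLS (j k : ι) (t : ℝ) : ℝ :=
  if k ∈ P.MC j then
    P.gammaSend j / P.gammaInter j * P.C * t + P.burstMax j * (P.gammaIdle j / P.gammaInter j)
  else P.C * t

/-! #### Service curves of the multiplexer for a class `k` that is not shaped -/

open Classical in
/-- Residual curve in which BLS classes are accounted for by `α_j ⊘ β_j^{bls}`. -/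
def betaSPcurve [Fintype ι] (β : ℝ → ℝ) (k : ι) : ℝ → EReal :=
  NetCalc.upClosure fun t =>
    (β t : EReal)
      - ∑ j with P.IsBLS j ∧ P.pH j < P.pH k, NetCalc.deconv (P.alpha j) (P.betaBLS j) t
      - ((∑ j with ¬ P.IsBLS j ∧ P.pH j < P.pH k, P.alpha j t : ℝ) : EReal)
      - (P.maxMFS (P.notHigher k) : EReal)

open Classical in
/-- Residual curve in which BLS classes are accounted for by `γ_j^{bls}`. -/
def betaBLScurve [Fintype ι] (β : ℝ → ℝ) (k : ι) : ℝ → EReal :=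
  NetCalc.upClosure fun t =>
    ((β t - ∑ j with P.IsBLS j ∧ P.pH j < P.pH k, P.gammaBLS j k t
      - ∑ j with ¬ P.IsBLS j ∧ P.pH j < P.pH k, P.alpha j t
      - P.maxMFS (P.notHigher k) : ℝ) : EReal)

end PortConfig

/-- Raw data of an execution of the output port. A transmitted frame is identified by the instant
at which its transmission starts. -/
structure PortTrace (ι : Type*) where
  /-- input cumulative function of a class: bits received before time `t` -/
  arr : ι → ℝ → ℝ
  /-- start instants of the transmissions -/
  starts : Set ℝ
  /-- class of the frame whose transmission starts at the given instant -/
  cls : ℝ → ι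
  /-- size of the frame whose transmission starts at the given instant -/
  len : ℝ → ℝ
  /-- credit counter of a BLS class -/
  credit : ι → ℝ → ℝ

namespace PortTrace

variable {ι : Type*} (P : PortConfig ι) (x : PortTrace ι)

/-- The frame started at `a` is in transmission at time `t`. -/
def sending (a t : ℝ) : Prop := a ∈ x.starts ∧ a ≤ t ∧ t < a + x.len a / P.C

/-- Output cumulative function of class `i`: bits transmitted at link speed up to time `t`. -/
def dep (i : ι) (t : ℝ) : ℝ :=
  ∑ᶠ a ∈ {a | a ∈ x.starts ∧ a ≤ t ∧ x.cls a = i}, min (x.len a) (P.C * (t - a))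

/-- Class `i` is backlogged at time `t`. -/
def backlogged (i : ι) (t : ℝ) : Prop := 0 < x.arr i t - x.dep P i t

/-- The BLS class `j` has its low priority at time `t`: the credit has reached `LM`, and has not
come down to `LR` since. -/
def low (j : ι) (t : ℝ) : Prop :=
  P.IsBLS j ∧ ∃ s ∈ Icc 0 t, x.credit j s = P.LM j ∧ ∀ τ ∈ Icc s t, P.LR j < x.credit j τ

open Classical in
/-- Current priority of class `i`. -/
def prio (i : ι) (t : ℝ) : ℕ := if x.low P i t then P.pL i else P.pH i

open Classical in
/-- Slope of the credit of the BLS class `j`: it grows while a frame of the class is transmitted,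
up to `LM`, and decreases otherwise, down to `0`. -/
def creditSlope (j : ι) (t : ℝ) : ℝ :=
  if ∃ a, x.sending P a t ∧ x.cls a = j then
    if x.credit j t < P.LM j then P.Isend j else 0
  else
    if 0 < x.credit j t then -P.Iidle j else 0

end PortTrace

/-- `x` is an execution of the output port `P`: a server of constant rate `C` under non-preemptive
static priority, the priorities of the BLS classes being driven by their credits. -/
structure IsExecution {ι : Type*} (P : PortConfig ι) (x : PortTrace ι) : Prop where
  /-- input functions vanish at the origin, are wide-sense increasing and left-continuous -/
  arr_zero : ∀ i t, t ≤ 0 → x.arr i t = 0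
  arr_mono : ∀ i, Monotone (x.arr i)
  arr_left : ∀ i t, ContinuousWithinAt (x.arr i) (Iic t) t
  /-- every class conforms to its arrival curve -/
  arr_curve : ∀ i, NetCalc.IsArrivalCurve (x.arr i) (P.alpha i)
  starts_nonneg : ∀ a ∈ x.starts, 0 ≤ a
  /-- finitely many transmissions start in a bounded time -/
  starts_finite : ∀ t, (x.starts ∩ Iic t).Finite
  len_pos : ∀ a ∈ x.starts, 0 < x.len a
  len_le : ∀ a ∈ x.starts, x.len a ≤ P.mfs (x.cls a)
  /-- one frame at a time, without preemption -/
  disjoint : ∀ a ∈ x.starts, ∀ a' ∈ x.starts, a < a' → a + x.len a / P.C ≤ a'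
  /-- store and forward: a frame has been received when its transmission starts -/
  received : ∀ a ∈ x.starts, ∀ t, a < t →
    x.dep P (x.cls a) a + x.len a ≤ x.arr (x.cls a) t
  /-- the link is busy whenever some class is backlogged -/
  work_conserving : ∀ t, 0 ≤ t → (∃ i, x.backlogged P i t) → ∃ a, x.sending P a t
  /-- the selected class has the highest current priority among the backlogged classes (a frame
  received at the very instant of the decision may be overlooked by the decision) -/
  priority : ∀ a ∈ x.starts, ∀ i, x.backlogged P i a → x.prio P (x.cls a) a ≤ x.prio P i a
  /-- the credit starts at `0`, is continuous and follows its slope -/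
  credit_zero : ∀ j, P.IsBLS j → x.credit j 0 = 0
  credit_cont : ∀ j, P.IsBLS j → ContinuousOn (x.credit j) (Ici 0)
  credit_deriv : ∀ j, P.IsBLS j → ∀ t, 0 ≤ t →
    HasDerivWithinAt (x.credit j) (x.creditSlope P j t) (Ici t) t

end

/-! ### Real functions with a one-sided derivative -/

/-! While `k` is backlogged the link is busy, so the classes together send exactly `C v` over a
duration `v`. Hence `β v ≤ C v`, and `β` may be replaced by `C v`. The closure `↑` costs nothing,
since each initial subperiod of a backlogged period is backlogged. It remains to bound the output of
the other classes.

Curve with `α_j ⊘ β_j^bls`. From `s` on, a class sends at most `α_i (t - s)` plus its `excess` at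
`s`. If `r_j` exceeds the slope of `β_j^bls`, the deconvolution is `⊤` and the curve is `0`.
Otherwise the deconvolution is at least `α_j (· + Δ_idle)`, so it suffices to bound the total excess
of the higher classes by the sum of the `r_j Δ_idle`, up to the effect of one lower frame, which the
term in `MFS` absorbs. No service guarantee for each shaped class separately is used: the bound is a
joint one (`excessBound`), by induction on the priority level. When a lower frame starts, a
backlogged class `j` above it must be shaped and at its low priority. The potential `creditFloor`
then shows that the output of `j` plus `BW j` times the output of `HC(j)` has kept a guaranteed rate
since the credit last had to be `0` (`excess_shaped`); the inductive bound, with weight `1 - BW j`,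
completes the estimate.

Curve with `γ_j^bls`. If `k ∉ MC(j)` for some higher shaped `j`, then `γ_j = C t` exhausts the link
and the claim is trivial. Otherwise the period is extended back to the last instant `u` at which the
higher unshaped classes had no backlog. After `u` no higher shaped class starts a frame at its low
priority, and the potential `creditCeil` bounds its output (`dep_le_gamma`). The resulting bound is
affine in the duration, which allows the return from `t - u` to `t - s`. -/

theorem sub_le_mul_of_deriv_right_le {f f' : ℝ → ℝ} {a b m : ℝ} (hab : a ≤ b)
    (hf : ContinuousOn f (Icc a b)) (hf' : ∀ x ∈ Ico a b, HasDerivWithinAt f (f' x) (Ici x) x)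
    (bound : ∀ x ∈ Ico a b, f' x ≤ m) : f b ≤ f a + m * (b - a) := by
  refine image_le_of_deriv_right_le_deriv_boundary (B := fun x => f a + m * (x - a))
    (B' := fun _ => m) hf hf' (by simp) (by fun_prop) (fun x _ => ?_) bound ⟨hab, le_rfl⟩
  have : HasDerivAt (fun x => f a + m * (x - a)) (m * 1) x :=
    (((hasDerivAt_id x).sub_const a).const_mul m).const_add (f a)
  simpa using this.hasDerivWithinAt

theorem mul_le_sub_of_le_deriv_right {f f' : ℝ → ℝ} {a b m : ℝ} (hab : a ≤ b)
    (hf : ContinuousOn f (Icc a b)) (hf' : ∀ x ∈ Ico a b, HasDerivWithinAt f (f' x) (Ici x) x)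
    (bound : ∀ x ∈ Ico a b, m ≤ f' x) : f a + m * (b - a) ≤ f b := by
  have := sub_le_mul_of_deriv_right_le (f := fun x => -f x) (f' := fun x => -f' x) (m := -m) hab
    hf.neg (fun x hx => (hf' x hx).neg) (fun x hx => neg_le_neg (bound x hx))
  linarith

/-- The last instant of `[0, t]` at which an increasing output has caught up with a
left-continuous input. -/
theorem exists_last_caught_up {A D : ℝ → ℝ} (hA : ∀ t, ContinuousWithinAt A (Iic t) t)
    (hD : Monotone D) (h0 : A 0 ≤ D 0) {t : ℝ} (ht : 0 ≤ t) :
    ∃ u ∈ Icc 0 t, A u ≤ D u ∧ ∀ τ ∈ Ioc u t, D τ < A τ := by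
  set S := {τ | τ ∈ Icc 0 t ∧ A τ ≤ D τ} with hS
  have hne : S.Nonempty := ⟨0, ⟨le_rfl, ht⟩, h0⟩
  have hbdd : BddAbove S := ⟨t, fun τ h => h.1.2⟩
  have hlub := isLUB_csSup hne hbdd
  set u := sSup S
  have hu0 : 0 ≤ u := hlub.1 ⟨⟨le_rfl, ht⟩, h0⟩
  have hut : u ≤ t := hlub.2 fun τ h => h.1.2
  refine ⟨u, ⟨hu0, hut⟩, ?_, fun τ hτ => ?_⟩
  · by_contra hlt
    push Not at hlt
    have hev : ∀ᶠ τ in 𝓝[≤] u, D u < A τ := (hA u).eventually (lt_mem_nhds hlt)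
    obtain ⟨l, hl, hsub⟩ := (mem_nhdsLE_iff_exists_Ioc_subset).1 hev
    obtain ⟨τ, hτS, hlτ, hτu⟩ := hlub.exists_between hl
    have h1 : D u < A τ := hsub ⟨hlτ, hτu⟩
    have h2 := hD hτu
    linarith [hτS.2]
  · by_contra hle
    push Not at hle
    exact absurd (hlub.1 ⟨⟨hu0.trans hτ.1.le, hτ.2⟩, hle⟩) (not_le.2 hτ.1)

/-! ### Transmitted bits and elementary facts on the parameters -/

namespace PortTrace

variable {ι : Type*} (P : PortConfig ι) (x : PortTrace ι)

/-- Bits of the frame started at `a` transmitted up to time `t`. -/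
noncomputable def sent (a t : ℝ) : ℝ := max 0 (min (x.len a) (P.C * (t - a)))

theorem sent_mono (a : ℝ) : Monotone (x.sent P a) := fun s t h =>
  max_le_max le_rfl (min_le_min le_rfl (by have := P.C_pos; gcongr))

end PortTrace

namespace PortConfig

variable {ι : Type*} (P : PortConfig ι)

theorem mfs_le_maxMFS [Finite ι] {S : Set ι} {i : ι} (hi : i ∈ S) : P.mfs i ≤ P.maxMFS S :=
  le_ciSup (f := fun i : S => P.mfs i) (Set.finite_range _).bddAbove ⟨i, hi⟩

theorem maxMFS_nonneg (S : Set ι) : 0 ≤ P.maxMFS S := Real.iSup_nonneg fun i => P.mfs_nonneg i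

theorem maxMFS_le {S : Set ι} {m : ℝ} (hm : 0 ≤ m) (h : ∀ i ∈ S, P.mfs i ≤ m) :
    P.maxMFS S ≤ m := Real.iSup_le (fun i => h i i.2) hm

variable {P} {j : ι}

theorem Iidle_pos (hj : P.IsBLS j) : 0 < P.Iidle j := mul_pos (P.BW_pos j hj) P.C_pos

theorem Isend_pos (hj : P.IsBLS j) : 0 < P.Isend j := by
  have := mul_lt_mul_of_pos_right (P.BW_lt_one j hj) P.C_pos
  unfold Isend Iidle
  linarith

theorem Isend_add_Iidle (j : ι) : P.Isend j + P.Iidle j = P.C := by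
  unfold Isend
  ring

theorem LM_pos (hj : P.IsBLS j) : 0 < P.LM j := (P.LR_nonneg j hj).trans_lt (P.LR_lt_LM j hj)

end PortConfig

/-! ### Busy periods, outputs, priorities and credits along an execution -/

namespace IsExecution

variable {ι : Type*} {P : PortConfig ι} {x : PortTrace ι} (hx : IsExecution P x)
include hx

theorem dur_pos {a : ℝ} (ha : a ∈ x.starts) : 0 < x.len a / P.C :=
  div_pos (hx.len_pos a ha) P.C_pos

theorem sending_unique {a a' t : ℝ} (h : x.sending P a t) (h' : x.sending P a' t) : a = a' := by
  obtain ⟨ha, hat, hat'⟩ := h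
  obtain ⟨hb, hbt, hbt'⟩ := h'
  rcases lt_trichotomy a a' with hlt | heq | hlt
  · linarith [hx.disjoint a ha a' hb hlt]
  · exact heq
  · linarith [hx.disjoint a' hb a ha hlt]

/-- Proof by induction on the frames transmitted during a busy period of the link. -/
theorem busy_induction {t₀ t₁ : ℝ} (h01 : t₀ ≤ t₁)
    (busy : ∀ τ ∈ Ico t₀ t₁, ∃ a, x.sending P a τ) {p : ℝ → Prop} (base : p t₀)
    (step : ∀ a b b', a ∈ x.starts → t₀ ≤ b → b < b' → b' ≤ t₁ → a ≤ b →
      b' ≤ a + x.len a / P.C → (b = t₀ ∨ b = a ∧ t₀ < a) → p b → p b') : p t₁ := by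
  -- Induction on the number of transmissions that start in `]b, t₁]`, which is finite.
  have key : ∀ n : ℕ, ∀ b, (b = t₀ ∨ b ∈ x.starts ∧ t₀ < b) → t₀ ≤ b → b ≤ t₁ → p b →
      (x.starts ∩ Ioc b t₁).ncard < n → p t₁ := by
    intro n
    induction n with
    | zero => exact fun b _ _ _ _ hn => absurd hn (Nat.not_lt_zero _)
    | succ n ih =>
      intro b hb h0b hb1 hpb hn
      rcases hb1.eq_or_lt with rfl | hlt
      · exact hpb
      obtain ⟨a, has, hab, hba⟩ := busy b ⟨h0b, hlt⟩
      have hba' : b = t₀ ∨ b = a ∧ t₀ < a := by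
        refine hb.imp_right fun ⟨hbs, hlt'⟩ => ?_
        have := hx.sending_unique ⟨has, hab, hba⟩ ⟨hbs, le_rfl, by linarith [hx.dur_pos hbs]⟩
        exact ⟨this.symm, this ▸ hlt'⟩
      rcases le_or_gt t₁ (a + x.len a / P.C) with hle | hcon
      · exact step a b t₁ has h0b hlt le_rfl hab hle hba' hpb
      obtain ⟨a', has', hab', hba''⟩ := busy (a + x.len a / P.C) ⟨by linarith, hcon⟩
      have haa : a < a' := by
        by_contra hle
        push Not at hle
        rcases hle.eq_or_lt with rfl | hlt'
        · exact lt_irrefl _ hba''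
        · linarith [hx.disjoint a' has' a has hlt', hx.dur_pos has]
      have heq : a' = a + x.len a / P.C := le_antisymm hab' (hx.disjoint a has a' has' haa)
      have hfin : (x.starts ∩ Ioc b t₁).Finite :=
        (hx.starts_finite t₁).subset fun z hz => ⟨hz.1, hz.2.2⟩
      have hss : (x.starts ∩ Ioc a' t₁) ⊂ (x.starts ∩ Ioc b t₁) := by
        refine ⟨fun z hz => ⟨hz.1, by linarith [hz.2.1], hz.2.2⟩, fun hsub => ?_⟩
        have : a' ∈ x.starts ∩ Ioc a' t₁ := hsub ⟨has', by linarith, by linarith⟩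
        exact lt_irrefl _ this.2.1
      refine ih a' (Or.inr ⟨has', by linarith⟩) (by linarith) (by linarith) ?_
        (by have := Set.ncard_lt_ncard hss hfin; omega)
      rw [heq]
      exact step a b _ has h0b hba hcon.le hab le_rfl hba' hpb
  exact key _ t₀ (Or.inl rfl) le_rfl h01 base (Nat.lt_succ_self _)

/-- If some frame is in transmission at every instant of `]s, t]`, this is so on `[s, t[`. -/
theorem busy_Ico {s t : ℝ} (h : ∀ τ ∈ Ioc s t, ∃ a, x.sending P a τ) :
    ∀ τ ∈ Ico s t, ∃ a, x.sending P a τ := by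
  intro τ ⟨hsτ, hτt⟩
  set F := x.starts ∩ Ioc τ t with hF
  have hfin : F.Finite := (hx.starts_finite t).subset fun z hz => ⟨hz.1, hz.2.2⟩
  -- No transmission starts in `]τ, e]`, so the frame in transmission at `e` was already there at
  -- `τ`.
  obtain ⟨e, heτ, het, he⟩ : ∃ e, τ < e ∧ e ≤ t ∧ ∀ z ∈ F, e < z := by
    rcases F.eq_empty_or_nonempty with h0 | hne
    · exact ⟨t, hτt, le_rfl, by simp [h0]⟩
    · obtain ⟨m, hm, hmin⟩ := Set.exists_min_image F id hfin hne
      have h1 : τ < m := hm.2.1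
      have h2 : m ≤ t := hm.2.2
      exact ⟨(τ + m) / 2, by linarith, by linarith,
        fun z hz => by have : m ≤ z := hmin z hz; linarith⟩
  obtain ⟨a, has, hae, hea⟩ := h e ⟨by linarith, het⟩
  refine ⟨a, has, ?_, by linarith⟩
  by_contra hlt
  push Not at hlt
  linarith [he a ⟨has, hlt, by linarith⟩]

/-! #### Output functions -/

/-- A frame not yet started contributes `0` to `sent`, so one finite index set serves all instants
up to `T` and differences of outputs can be taken frame by frame. -/
theorem dep_eq (i : ι) {t T : ℝ} (htT : t ≤ T) : x.dep P i t =
    ∑ᶠ a ∈ {a | a ∈ x.starts ∧ a ≤ T ∧ x.cls a = i}, x.sent P a t := by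
  have hT : {a | a ∈ x.starts ∧ a ≤ T ∧ x.cls a = i}.Finite :=
    (hx.starts_finite T).subset fun z hz => ⟨hz.1, hz.2.1⟩
  have ht : {a | a ∈ x.starts ∧ a ≤ t ∧ x.cls a = i}.Finite :=
    (hx.starts_finite t).subset fun z hz => ⟨hz.1, hz.2.1⟩
  unfold PortTrace.dep
  rw [finsum_mem_eq_finite_toFinset_sum _ hT, finsum_mem_eq_finite_toFinset_sum _ ht]
  have h1 : ∑ a ∈ ht.toFinset, min (x.len a) (P.C * (t - a)) =
      ∑ a ∈ ht.toFinset, x.sent P a t := by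
    refine Finset.sum_congr rfl fun a ha => ?_
    rw [Set.Finite.mem_toFinset] at ha
    exact (max_eq_right (le_min (hx.len_pos a ha.1).le
      (mul_nonneg P.C_pos.le (sub_nonneg.2 ha.2.1)))).symm
  rw [h1]
  refine Finset.sum_subset (fun a ha => ?_) fun a ha hna => ?_
  · rw [Set.Finite.mem_toFinset] at ha ⊢
    exact ⟨ha.1, ha.2.1.trans htT, ha.2.2⟩
  · rw [Set.Finite.mem_toFinset] at ha hna
    have hta : t < a := by
      by_contra hle
      exact hna ⟨ha.1, not_lt.1 hle, ha.2.2⟩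
    exact max_eq_left ((min_le_right _ _).trans
      (mul_nonpos_of_nonneg_of_nonpos P.C_pos.le (by linarith)))

theorem dep_mono (i : ι) : Monotone (x.dep P i) := by
  intro s t hst
  have hT : {a | a ∈ x.starts ∧ a ≤ t ∧ x.cls a = i}.Finite :=
    (hx.starts_finite t).subset fun z hz => ⟨hz.1, hz.2.1⟩
  rw [hx.dep_eq i hst, hx.dep_eq i le_rfl, finsum_mem_eq_finite_toFinset_sum _ hT,
    finsum_mem_eq_finite_toFinset_sum _ hT]
  exact Finset.sum_le_sum fun a _ => x.sent_mono P a hst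

omit hx in
theorem sent_before {a t : ℝ} (h : t ≤ a) : x.sent P a t = 0 :=
  max_eq_left ((min_le_right _ _).trans
    (mul_nonpos_of_nonneg_of_nonpos P.C_pos.le (by linarith)))

theorem sent_after {a t : ℝ} (ha : a ∈ x.starts) (h : a + x.len a / P.C ≤ t) :
    x.sent P a t = x.len a := by
  have h1 : x.len a ≤ P.C * (t - a) := by
    have := P.C_pos
    rw [← div_le_iff₀' this]
    linarith
  rw [PortTrace.sent, min_eq_left h1, max_eq_right (hx.len_pos a ha).le]

omit hx in
theorem sent_during {a t : ℝ} (h0 : a ≤ t) (h : t ≤ a + x.len a / P.C) :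
    x.sent P a t = P.C * (t - a) := by
  have h1 : P.C * (t - a) ≤ x.len a := by
    have := P.C_pos
    rw [← le_div_iff₀' this]
    linarith
  rw [PortTrace.sent, min_eq_right h1, max_eq_right (mul_nonneg P.C_pos.le (by linarith))]

open Classical in
/-- Output during (a part of) the transmission of a frame. -/
theorem dep_sub_dep (i : ι) {a b b' : ℝ} (ha : a ∈ x.starts) (hab : a ≤ b) (hbb : b ≤ b')
    (hba : b' ≤ a + x.len a / P.C) :
    x.dep P i b' - x.dep P i b = if x.cls a = i then P.C * (b' - b) else 0 := by
  have hT : {a | a ∈ x.starts ∧ a ≤ b' ∧ x.cls a = i}.Finite :=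
    (hx.starts_finite b').subset fun z hz => ⟨hz.1, hz.2.1⟩
  rw [hx.dep_eq i hbb, hx.dep_eq i le_rfl, finsum_mem_eq_finite_toFinset_sum _ hT,
    finsum_mem_eq_finite_toFinset_sum _ hT, ← Finset.sum_sub_distrib]
  have hz : ∀ z ∈ hT.toFinset, z ≠ a → x.sent P z b' - x.sent P z b = 0 := by
    intro z hz hne
    rw [Set.Finite.mem_toFinset] at hz
    rcases lt_or_gt_of_ne hne with hlt | hlt
    · have := hx.disjoint z hz.1 a ha hlt
      rw [hx.sent_after hz.1 (by linarith), hx.sent_after hz.1 (by linarith), sub_self]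
    · have := hx.disjoint a ha z hz.1 hlt
      rw [sent_before (by linarith), sent_before (by linarith), sub_self]
  split_ifs with hi
  · rw [Finset.sum_eq_single a hz]
    · rw [sent_during (by linarith) hba, sent_during hab (by linarith)]
      ring
    · intro hna
      rw [Set.Finite.mem_toFinset] at hna
      exact absurd ⟨ha, by linarith, hi⟩ hna
  · refine Finset.sum_eq_zero fun z hz' => hz z hz' ?_
    rintro rfl
    rw [Set.Finite.mem_toFinset] at hz'
    exact hi hz'.2.2

open Classical in
theorem sum_dep_sub_dep (S : Finset ι) {a b b' : ℝ} (ha : a ∈ x.starts) (hab : a ≤ b)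
    (hbb : b ≤ b') (hba : b' ≤ a + x.len a / P.C) :
    ∑ i ∈ S, x.dep P i b' - ∑ i ∈ S, x.dep P i b =
      if x.cls a ∈ S then P.C * (b' - b) else 0 := by
  rw [← Finset.sum_sub_distrib, Finset.sum_congr rfl fun i _ => hx.dep_sub_dep i ha hab hbb hba,
    Finset.sum_ite_eq]

theorem arr_nonneg (i : ι) (t : ℝ) : 0 ≤ x.arr i t := by
  rcases le_total t 0 with h | h
  · rw [hx.arr_zero i t h]
  · exact (hx.arr_zero i 0 le_rfl).symm.le.trans (hx.arr_mono i h)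

/-- The last frame of the class started before `t` is entirely received by `t`, and the output since
its start is at most its length. -/
theorem dep_le_arr (i : ι) (t : ℝ) : x.dep P i t ≤ x.arr i t := by
  have hT : {a | a ∈ x.starts ∧ a ≤ t ∧ x.cls a = i}.Finite :=
    (hx.starts_finite t).subset fun z hz => ⟨hz.1, hz.2.1⟩
  set F := {a | a ∈ x.starts ∧ a < t ∧ x.cls a = i} with hF
  have hFfin : F.Finite := hT.subset fun z hz => ⟨hz.1, hz.2.1.le, hz.2.2⟩
  rcases F.eq_empty_or_nonempty with h0 | hne
  · have : x.dep P i t = 0 := by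
      rw [hx.dep_eq i le_rfl, finsum_mem_eq_finite_toFinset_sum _ hT]
      refine Finset.sum_eq_zero fun z hz => sent_before ?_
      rw [Set.Finite.mem_toFinset] at hz
      by_contra hlt
      have : z ∈ F := ⟨hz.1, not_le.1 hlt, hz.2.2⟩
      simp [h0] at this
    rw [this]
    exact hx.arr_nonneg i t
  · obtain ⟨a, ⟨ha, hat, hai⟩, hmax⟩ := Set.exists_max_image F id hFfin hne
    have hrec := hx.received a ha t hat
    rw [hai] at hrec
    have : x.dep P i t - x.dep P i a ≤ x.len a := by
      rw [hx.dep_eq i hat.le, hx.dep_eq i le_rfl, finsum_mem_eq_finite_toFinset_sum _ hT,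
        finsum_mem_eq_finite_toFinset_sum _ hT, ← Finset.sum_sub_distrib]
      have hz : ∀ z ∈ hT.toFinset, z ≠ a → x.sent P z t - x.sent P z a = 0 := by
        intro z hz hne
        rw [Set.Finite.mem_toFinset] at hz
        rcases lt_or_ge z t with hzt | hzt
        · have hza : z < a := lt_of_le_of_ne (hmax z ⟨hz.1, hzt, hz.2.2⟩) hne
          have := hx.disjoint z hz.1 a ha hza
          rw [hx.sent_after hz.1 (by linarith), hx.sent_after hz.1 (by linarith), sub_self]
        · rw [sent_before hzt, sent_before (by linarith), sub_self]
      rw [Finset.sum_eq_single a hz]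
      · rw [sent_before (le_refl a), sub_zero]
        exact max_le (hx.len_pos a ha).le (min_le_left _ _)
      · intro hna
        rw [Set.Finite.mem_toFinset] at hna
        exact absurd ⟨ha, hat.le, hai⟩ hna
    linarith

theorem dep_nonneg (i : ι) (t : ℝ) : 0 ≤ x.dep P i t := by
  have hT : {a | a ∈ x.starts ∧ a ≤ t ∧ x.cls a = i}.Finite :=
    (hx.starts_finite t).subset fun z hz => ⟨hz.1, hz.2.1⟩
  rw [hx.dep_eq i le_rfl, finsum_mem_eq_finite_toFinset_sum _ hT]
  exact Finset.sum_nonneg fun a _ => le_max_left _ _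

/-- The link transmits at rate `C` while it is busy. -/
theorem sum_dep_of_busy [Fintype ι] {s t : ℝ} (hst : s ≤ t)
    (busy : ∀ τ ∈ Ico s t, ∃ a, x.sending P a τ) :
    ∑ i, x.dep P i t - ∑ i, x.dep P i s = P.C * (t - s) := by
  refine hx.busy_induction (p := fun τ => ∑ i, x.dep P i τ - ∑ i, x.dep P i s = P.C * (τ - s))
    hst busy (by simp) fun a b b' ha _ hbb _ hab hba _ hp => ?_
  have := hx.sum_dep_sub_dep Finset.univ ha hab hbb.le hba
  simp only [Finset.mem_univ, if_true] at this
  linarith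

/-- Service of classes that start no frame: only the frame in transmission counts. -/
theorem sum_dep_residual {S : Finset ι} {s t a₀ : ℝ} (hst : s < t)
    (busy : ∀ τ ∈ Ico s t, ∃ a, x.sending P a τ) (ha₀ : x.sending P a₀ s)
    (hS : ∀ a ∈ x.starts, a ∈ Ioc s t → x.cls a ∉ S) :
    (x.cls a₀ ∉ S → ∑ i ∈ S, x.dep P i t - ∑ i ∈ S, x.dep P i s = 0) ∧
      ∑ i ∈ S, x.dep P i t - ∑ i ∈ S, x.dep P i s ≤ P.C * (min t (a₀ + x.len a₀ / P.C) - s) := by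
  classical
  have hC := P.C_pos
  refine hx.busy_induction (p := fun τ =>
    (x.cls a₀ ∉ S → ∑ i ∈ S, x.dep P i τ - ∑ i ∈ S, x.dep P i s = 0) ∧
      ∑ i ∈ S, x.dep P i τ - ∑ i ∈ S, x.dep P i s ≤ P.C * (min τ (a₀ + x.len a₀ / P.C) - s))
    hst.le busy ?_ fun a b b' ha hsb hbb hbt hab hba hb hp => ?_
  · refine ⟨fun _ => sub_self _, ?_⟩
    rw [sub_self]
    exact mul_nonneg hC.le (sub_nonneg.2 (le_min le_rfl ha₀.2.2.le))
  have key := hx.sum_dep_sub_dep S ha hab hbb.le hba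
  rcases hb with rfl | ⟨rfl, hlt⟩
  · have haa : a = a₀ := hx.sending_unique ⟨ha, hab, by linarith⟩ ha₀
    subst haa
    refine ⟨fun h => by rw [key, if_neg h], ?_⟩
    rw [key, min_eq_left hba]
    split_ifs
    · exact le_rfl
    · exact mul_nonneg hC.le (by linarith)
  · rw [if_neg (hS b ha ⟨hlt, by linarith⟩)] at key
    have hmin : min b (a₀ + x.len a₀ / P.C) ≤ min b' (a₀ + x.len a₀ / P.C) :=
      min_le_min hbb.le le_rfl
    refine ⟨fun h => by linarith [hp.1 h], ?_⟩
    have := mul_le_mul_of_nonneg_left hmin hC.le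
    nlinarith [hp.2]

/-! #### Priorities -/

theorem busy_of_backlogged {s t : ℝ} (hs : 0 ≤ s)
    (h : ∀ τ ∈ Ioc s t, ∃ i, x.backlogged P i τ) : ∀ τ ∈ Ico s t, ∃ a, x.sending P a τ :=
  hx.busy_Ico fun τ hτ => hx.work_conserving τ (hs.trans hτ.1.le) (h τ hτ)

omit hx in
theorem prio_ge (i : ι) (t : ℝ) : P.pH i ≤ x.prio P i t := by
  unfold PortTrace.prio
  split_ifs
  · exact P.pH_le_pL i
  · exact le_rfl

omit hx in
theorem prio_of_low {i : ι} {t : ℝ} (h : x.low P i t) : x.prio P i t = P.pL i := if_pos h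

omit hx in
theorem prio_of_not_low {i : ι} {t : ℝ} (h : ¬ x.low P i t) : x.prio P i t = P.pH i := if_neg h

omit hx in
theorem prio_of_not_isBLS {i : ι} {t : ℝ} (h : ¬ P.IsBLS i) : x.prio P i t = P.pH i :=
  prio_of_not_low fun hl => h hl.1

/-! #### Credits -/

variable {j : ι} (hj : P.IsBLS j)
include hj

theorem credit_contOn {b b' : ℝ} (hb : 0 ≤ b) : ContinuousOn (x.credit j) (Icc b b') :=
  (hx.credit_cont j hj).mono fun _ h => hb.trans h.1

/-- After the last instant of nonnegative credit the credit would be negative, starting from `0` by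
continuity; but its slope is nonnegative wherever it is at most `0`. -/
theorem credit_nonneg {t : ℝ} (ht : 0 ≤ t) : 0 ≤ x.credit j t := by
  by_contra hneg
  push Not at hneg
  set S := {τ | τ ∈ Icc 0 t ∧ 0 ≤ x.credit j τ} with hS
  have hcomp : IsCompact S := by
    have hcl : IsClosed (Icc 0 t ∩ x.credit j ⁻¹' Ici 0) :=
      (hx.credit_contOn hj le_rfl).preimage_isClosed_of_isClosed isClosed_Icc isClosed_Ici
    exact isCompact_Icc.of_isClosed_subset hcl fun _ h => h.1
  obtain ⟨u, ⟨hu, hcu⟩, hmax⟩ := hcomp.exists_isGreatest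
    ⟨0, ⟨le_rfl, ht⟩, (hx.credit_zero j hj).symm.le⟩
  have hlt : ∀ τ ∈ Ioc u t, x.credit j τ < 0 := fun τ hτ => by
    by_contra hle
    exact absurd (hmax ⟨⟨hu.1.trans hτ.1.le, hτ.2⟩, not_lt.1 hle⟩) (not_le.2 hτ.1)
  have hut : u < t := lt_of_le_of_ne hu.2 fun h => by rw [h] at hcu; linarith
  have hcu0 : x.credit j u = 0 := by
    refine le_antisymm ?_ hcu
    have h1 : Tendsto (x.credit j) (𝓝[>] u) (𝓝 (x.credit j u)) :=
      ((hx.credit_cont j hj) u hu.1).mono_left (nhdsWithin_mono _ fun _ h => hu.1.trans (le_of_lt h))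
    refine le_of_tendsto h1 ?_
    filter_upwards [Ioc_mem_nhdsGT hut] with τ hτ using (hlt τ hτ).le
  have := mul_le_sub_of_le_deriv_right (m := 0) hut.le (hx.credit_contOn hj hu.1)
    (fun τ hτ => hx.credit_deriv j hj τ (hu.1.trans hτ.1)) fun τ hτ => by
      have hc : x.credit j τ ≤ 0 := by
        rcases hτ.1.eq_or_lt with rfl | h
        · exact hcu0.le
        · exact (hlt τ ⟨h, hτ.2.le⟩).le
      unfold PortTrace.creditSlope
      split_ifs
      · exact (P.Isend_pos hj).le
      · exact le_rfl
      · linarith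
      · exact le_rfl
  linarith

/-- Mirror image of the argument at `0`: at or above `LM` the slope is at most `0`. -/
theorem credit_le {t : ℝ} (ht : 0 ≤ t) : x.credit j t ≤ P.LM j := by
  by_contra hgt
  push Not at hgt
  set S := {τ | τ ∈ Icc 0 t ∧ x.credit j τ ≤ P.LM j} with hS
  have hcomp : IsCompact S := by
    have hcl : IsClosed (Icc 0 t ∩ x.credit j ⁻¹' Iic (P.LM j)) :=
      (hx.credit_contOn hj le_rfl).preimage_isClosed_of_isClosed isClosed_Icc isClosed_Iic
    exact isCompact_Icc.of_isClosed_subset hcl fun _ h => h.1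
  obtain ⟨u, ⟨hu, hcu⟩, hmax⟩ := hcomp.exists_isGreatest
    ⟨0, ⟨le_rfl, ht⟩, (hx.credit_zero j hj).le.trans (PortConfig.LM_pos hj).le⟩
  have hlt : ∀ τ ∈ Ioc u t, P.LM j < x.credit j τ := fun τ hτ => by
    by_contra hle
    exact absurd (hmax ⟨⟨hu.1.trans hτ.1.le, hτ.2⟩, not_lt.1 hle⟩) (not_le.2 hτ.1)
  have hut : u < t := lt_of_le_of_ne hu.2 fun h => by rw [h] at hcu; linarith
  have hcu0 : P.LM j ≤ x.credit j u := by
    have h1 : Tendsto (x.credit j) (𝓝[>] u) (𝓝 (x.credit j u)) :=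
      ((hx.credit_cont j hj) u hu.1).mono_left (nhdsWithin_mono _ fun _ h => hu.1.trans (le_of_lt h))
    refine ge_of_tendsto h1 ?_
    filter_upwards [Ioc_mem_nhdsGT hut] with τ hτ using (hlt τ hτ).le
  have := sub_le_mul_of_deriv_right_le (m := 0) hut.le (hx.credit_contOn hj hu.1)
    (fun τ hτ => hx.credit_deriv j hj τ (hu.1.trans hτ.1)) fun τ hτ => by
      have hc : P.LM j ≤ x.credit j τ := by
        rcases hτ.1.eq_or_lt with rfl | h
        · exact hcu0
        · exact (hlt τ ⟨h, hτ.2.le⟩).le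
      unfold PortTrace.creditSlope
      split_ifs
      · linarith
      · exact le_rfl
      · linarith [P.Iidle_pos hj]
      · exact le_rfl
  linarith

/-- Credit during the transmission of a frame of the class. -/
theorem credit_send {a b b' : ℝ} (ha : a ∈ x.starts) (hab : a ≤ b) (hbb : b ≤ b')
    (hba : b' ≤ a + x.len a / P.C) (hcls : x.cls a = j) :
    x.credit j b ≤ x.credit j b' ∧ x.credit j b' ≤ x.credit j b + P.Isend j * (b' - b) ∧
      (x.credit j b' = P.LM j ∨ x.credit j b' = x.credit j b + P.Isend j * (b' - b)) := by
  have hb0 : 0 ≤ b := (hx.starts_nonneg a ha).trans hab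
  have hs := P.Isend_pos hj
  have hslope : ∀ τ ∈ Ico b b', x.creditSlope P j τ =
      if x.credit j τ < P.LM j then P.Isend j else 0 := fun τ hτ =>
    if_pos ⟨a, ⟨ha, hab.trans hτ.1, hτ.2.trans_le hba⟩, hcls⟩
  have hmono : ∀ τ ∈ Icc b b', x.credit j τ ≤ x.credit j b' := fun τ hτ => by
    have := mul_le_sub_of_le_deriv_right (m := 0) hτ.2 (hx.credit_contOn hj (hb0.trans hτ.1))
      (fun z hz => hx.credit_deriv j hj z (hb0.trans (hτ.1.trans hz.1))) fun z hz => by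
        rw [hslope z ⟨hτ.1.trans hz.1, hz.2⟩]
        split_ifs
        · exact hs.le
        · exact le_rfl
    linarith
  have hup := sub_le_mul_of_deriv_right_le (m := P.Isend j) hbb (hx.credit_contOn hj hb0)
      (fun z hz => hx.credit_deriv j hj z (hb0.trans hz.1)) fun z hz => by
        rw [hslope z hz]
        split_ifs
        · exact le_rfl
        · exact hs.le
  refine ⟨hmono b ⟨le_rfl, hbb⟩, hup, ?_⟩
  rcases (hx.credit_le hj (hb0.trans hbb)).eq_or_lt with h | h
  · exact Or.inl h
  refine Or.inr (le_antisymm hup ?_)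
  refine mul_le_sub_of_le_deriv_right (m := P.Isend j) hbb (hx.credit_contOn hj hb0)
      (fun z hz => hx.credit_deriv j hj z (hb0.trans hz.1)) fun z hz => ?_
  rw [hslope z hz, if_pos ((hmono z ⟨hz.1, hz.2.le⟩).trans_lt h)]

/-- Credit during the transmission of a frame of another class. -/
theorem credit_idle {a b b' : ℝ} (ha : a ∈ x.starts) (hab : a ≤ b) (hbb : b ≤ b')
    (hba : b' ≤ a + x.len a / P.C) (hcls : x.cls a ≠ j) :
    x.credit j b' ≤ x.credit j b ∧ x.credit j b - P.Iidle j * (b' - b) ≤ x.credit j b' ∧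
      (x.credit j b' = 0 ∨ x.credit j b' = x.credit j b - P.Iidle j * (b' - b)) := by
  have hb0 : 0 ≤ b := (hx.starts_nonneg a ha).trans hab
  have hs := P.Iidle_pos hj
  have hslope : ∀ τ ∈ Ico b b', x.creditSlope P j τ =
      if 0 < x.credit j τ then -P.Iidle j else 0 := fun τ hτ => by
    refine if_neg ?_
    rintro ⟨a', ha', hcls'⟩
    exact hcls (hx.sending_unique ⟨ha, hab.trans hτ.1, hτ.2.trans_le hba⟩ ha' ▸ hcls')
  have hmono : ∀ τ ∈ Icc b b', x.credit j b' ≤ x.credit j τ := fun τ hτ => by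
    have := sub_le_mul_of_deriv_right_le (m := 0) hτ.2 (hx.credit_contOn hj (hb0.trans hτ.1))
      (fun z hz => hx.credit_deriv j hj z (hb0.trans (hτ.1.trans hz.1))) fun z hz => by
        rw [hslope z ⟨hτ.1.trans hz.1, hz.2⟩]
        split_ifs
        · linarith
        · exact le_rfl
    linarith
  have hlo := mul_le_sub_of_le_deriv_right (m := -P.Iidle j) hbb (hx.credit_contOn hj hb0)
      (fun z hz => hx.credit_deriv j hj z (hb0.trans hz.1)) fun z hz => by
        rw [hslope z hz]
        split_ifs
        · exact le_rfl
        · linarith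
  refine ⟨hmono b ⟨le_rfl, hbb⟩, by linarith, ?_⟩
  rcases (hx.credit_nonneg hj (hb0.trans hbb)).eq_or_lt with h | h
  · exact Or.inl h.symm
  refine Or.inr (le_antisymm ?_ (by linarith))
  have := sub_le_mul_of_deriv_right_le (m := -P.Iidle j) hbb (hx.credit_contOn hj hb0)
      (fun z hz => hx.credit_deriv j hj z (hb0.trans hz.1)) fun z hz => by
        rw [hslope z hz, if_pos (h.trans_le (hmono z ⟨hz.1, hz.2.le⟩))]
  linarith

omit hx in
/-- A class whose credit is at `LM` has its low priority. -/
theorem low_of_credit_eq {t : ℝ} (ht : 0 ≤ t) (h : x.credit j t = P.LM j) : x.low P j t :=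
  ⟨hj, t, ⟨ht, le_rfl⟩, h, fun τ hτ => by
    rw [le_antisymm hτ.2 hτ.1, h]
    exact P.LR_lt_LM j hj⟩

omit hx hj in
theorem LR_lt_credit_of_low {t : ℝ} (h : x.low P j t) : P.LR j < x.credit j t := by
  obtain ⟨_, s, hs, _, h⟩ := h
  exact h t ⟨hs.2, le_rfl⟩

/-- A class that gets its low priority during the transmission of a frame of its own has its
credit at `LM` at the end. -/
theorem credit_eq_of_low_send {a b b' : ℝ} (ha : a ∈ x.starts) (hab : a ≤ b) (hbb : b ≤ b')
    (hba : b' ≤ a + x.len a / P.C) (hcls : x.cls a = j) (hb : ¬ x.low P j b)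
    (hb' : x.low P j b') : x.credit j b' = P.LM j := by
  have hb0 : 0 ≤ b := (hx.starts_nonneg a ha).trans hab
  obtain ⟨_, s, hs, hcs, hlow⟩ := hb'
  rcases le_or_gt s b with hsb | hsb
  · exact absurd ⟨hj, s, ⟨hs.1, hsb⟩, hcs, fun τ hτ => hlow τ ⟨hτ.1, hτ.2.trans hbb⟩⟩ hb
  · refine le_antisymm (hx.credit_le hj (hb0.trans hbb)) ?_
    rw [← hcs]
    exact (hx.credit_send hj ha (hab.trans hsb.le) hs.2 hba hcls).1

/-- A credit that does not increase can be at `LM` later only if it is there already, and then the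
class is already low. -/
theorem not_low_idle {a b b' : ℝ} (ha : a ∈ x.starts) (hab : a ≤ b) (hbb : b ≤ b')
    (hba : b' ≤ a + x.len a / P.C) (hcls : x.cls a ≠ j) (hb : ¬ x.low P j b) :
    ¬ x.low P j b' := by
  have hb0 : 0 ≤ b := (hx.starts_nonneg a ha).trans hab
  rintro ⟨_, s, hs, hcs, hlow⟩
  rcases le_or_gt s b with hsb | hsb
  · exact hb ⟨hj, s, ⟨hs.1, hsb⟩, hcs, fun τ hτ => hlow τ ⟨hτ.1, hτ.2.trans hbb⟩⟩
  · refine hb (low_of_credit_eq hj hb0 (le_antisymm (hx.credit_le hj hb0) ?_))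
    rw [← hcs]
    exact (hx.credit_idle hj ha hab hsb.le (hs.2.trans hba) hcls).1

theorem low_send {a b b' : ℝ} (ha : a ∈ x.starts) (hab : a ≤ b) (hbb : b ≤ b')
    (hba : b' ≤ a + x.len a / P.C) (hcls : x.cls a = j) (hb : x.low P j b) :
    x.low P j b' := by
  obtain ⟨_, s, hs, hcs, hlow⟩ := hb
  refine ⟨hj, s, ⟨hs.1, hs.2.trans hbb⟩, hcs, fun τ hτ => ?_⟩
  rcases le_or_gt τ b with h | h
  · exact hlow τ ⟨hτ.1, h⟩
  · exact (hlow b ⟨hs.2, le_rfl⟩).trans_le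
      (hx.credit_send hj ha hab h.le (hτ.2.trans hba) hcls).1

/-- As the credit is decreasing here, a final value above `LR` would mean that it stayed above `LR`
throughout, so the low priority would persist. -/
theorem credit_le_of_not_low_idle {a b b' : ℝ} (ha : a ∈ x.starts) (hab : a ≤ b) (hbb : b ≤ b')
    (hba : b' ≤ a + x.len a / P.C) (hcls : x.cls a ≠ j) (hb : x.low P j b)
    (hb' : ¬ x.low P j b') : x.credit j b' ≤ P.LR j := by
  by_contra hlt
  push Not at hlt
  obtain ⟨_, s, hs, hcs, hlow⟩ := hb
  refine hb' ⟨hj, s, ⟨hs.1, hs.2.trans hbb⟩, hcs, fun τ hτ => ?_⟩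
  rcases le_or_gt τ b with h | h
  · exact hlow τ ⟨hτ.1, h⟩
  · exact hlt.trans_le (hx.credit_idle hj ha (hab.trans h.le) hτ.2 hba hcls).1

end IsExecution

/-! ### Constants of the minimum service analysis -/

namespace PortConfig

variable {ι : Type*} (P : PortConfig ι)

/-- Share of the time during which the credit of class `j` may stay at `0` while a frame of
`MC(j)` is transmitted. -/
noncomputable def satRatio (j : ι) : ℝ := P.mfsSat j / (P.C * P.betaInter j)

theorem mfsSat_nonneg (j : ι) : 0 ≤ P.mfsSat j := le_max_right _ _

/-- Maximum frame size over the classes that can have a priority level not above `p`. -/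
noncomputable def maxMFSBelow (p : ℕ) : ℝ := P.maxMFS {i | p ≤ P.pL i}

variable {P} {j : ι}

theorem betaIdle_nonneg (hj : P.IsBLS j) : 0 ≤ P.betaIdle j :=
  add_nonneg (div_nonneg (sub_nonneg.2 (P.LR_lt_LM j hj).le) (P.Iidle_pos hj).le)
    (div_nonneg (P.maxMFS_nonneg _) P.C_pos.le)

theorem betaInter_pos (hj : P.IsBLS j) : 0 < P.betaInter j := by
  have h1 : P.LRmin j ≤ P.LR j := max_le (sub_le_self _ (mul_nonneg
    (div_nonneg (P.maxMFS_nonneg _) P.C_pos.le) (P.Iidle_pos hj).le)) (P.LR_nonneg j hj)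
  have h2 := P.LR_lt_LM j hj
  have h3 : 0 < (P.LM j - P.LRmin j) / P.Isend j := div_pos (by linarith) (P.Isend_pos hj)
  have h4 := P.betaIdle_nonneg hj
  unfold betaIdle at h4
  unfold betaInter
  linarith

theorem satRatio_nonneg (hj : P.IsBLS j) : 0 ≤ P.satRatio j :=
  div_nonneg (P.mfsSat_nonneg j) (mul_pos P.C_pos (P.betaInter_pos hj)).le

/-- This is the balance that fixes `satRatio`: the service lost while the credit sits at `0` under
an `MC(j)` frame equals the constant term of the low branch of `creditFloor`. If `mfsSat` is
positive then `LRmin = 0` and `betaInter` is the time to climb from `0` to `LM`, to come down again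
and to wait at `0`. -/
theorem satRatio_identity (hj : P.IsBLS j) : (1 - P.satRatio j) * (P.Iidle j * P.mfsSat j / P.C) =
    P.satRatio j * P.LM j * P.C / P.Isend j := by
  have hI := P.Iidle_pos hj
  have hS := P.Isend_pos hj
  have hC := P.C_pos
  have hB := P.betaInter_pos hj
  rcases (P.mfsSat_nonneg j).eq_or_lt with h0 | hpos
  · simp [satRatio, ← h0]
  have hsat : P.mfsSat j = P.maxMFS (P.MC j) - P.C / P.Iidle j * P.LR j := by
    rcases max_choice (P.maxMFS (P.MC j) - P.C / P.Iidle j * P.LR j) 0 with h | h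
    · exact h
    · exact absurd h hpos.ne'
  have hmin : P.LRmin j = 0 := by
    refine max_eq_right ?_
    have h1 : P.LR j - P.maxMFS (P.MC j) / P.C * P.Iidle j =
        -(P.mfsSat j * (P.Iidle j / P.C)) := by
      rw [hsat]
      field_simp
      ring
    rw [h1]
    exact neg_nonpos.2 (mul_pos hpos (div_pos hI hC)).le
  have hB' : P.betaInter j = P.LM j / P.Isend j + P.LM j / P.Iidle j + P.mfsSat j / P.C := by
    unfold betaInter
    rw [hmin, hsat]
    field_simp
    ring
  have hσ : P.satRatio j * P.betaInter j = P.mfsSat j / P.C := by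
    unfold satRatio
    field_simp
  have hCSI := P.Isend_add_Iidle j
  have h2 : (1 - P.satRatio j) * (P.mfsSat j / P.C) =
      P.satRatio j * (P.LM j / P.Isend j + P.LM j / P.Iidle j) := by
    rw [hB'] at hσ
    linarith
  have h3 : P.LM j / P.Isend j + P.LM j / P.Iidle j =
      P.LM j * P.C / (P.Isend j * P.Iidle j) := by
    rw [← hCSI]
    field_simp
    ring
  calc _ = P.Iidle j * ((1 - P.satRatio j) * (P.mfsSat j / P.C)) := by ring
    _ = _ := by rw [h2, h3]; field_simp

/-- During a frame of `MC(j)` the credit would lose at most this much; what exceeds `LR` is the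
saturated part, accounted for by `mfsSat`. -/
theorem Iidle_mul_maxMFS_le (hj : P.IsBLS j) :
    P.Iidle j * (P.maxMFS (P.MC j) / P.C) ≤ P.Iidle j * P.mfsSat j / P.C + P.LR j := by
  have hI := P.Iidle_pos hj
  have hC := P.C_pos
  have h : P.maxMFS (P.MC j) - P.C / P.Iidle j * P.LR j ≤ P.mfsSat j := le_max_left _ _
  have h1 := mul_le_mul_of_nonneg_left h (div_pos hI hC).le
  have h2 : P.Iidle j / P.C * (P.maxMFS (P.MC j) - P.C / P.Iidle j * P.LR j) =
      P.Iidle j * (P.maxMFS (P.MC j) / P.C) - P.LR j := by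
    field_simp
  have h3 : P.Iidle j / P.C * P.mfsSat j = P.Iidle j * P.mfsSat j / P.C := by ring
  linarith

variable (P) [Fintype ι]

/-- Classes whose high priority is above the level `p`. -/
def higher (p : ℕ) : Finset ι := Finset.univ.filter fun i => P.pH i < p

/-- Total rate of the classes in `P.higher p`. -/
noncomputable def rateAbove (p : ℕ) : ℝ := ∑ i ∈ P.higher p, P.r i

open Classical in
/-- Traffic received by the shaped classes in `P.higher p` while they are blocked. -/
noncomputable def idleBurst (p : ℕ) : ℝ :=
  ∑ i ∈ P.higher p, if P.IsBLS i then P.r i * P.betaIdle i else 0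

/-- The rate of class `j` does not exceed the rate of `β_j^{bls}`. -/
def RateOK (j : ι) : Prop :=
  P.r j + P.Iidle j / P.C * P.rateAbove (P.pH j) ≤ P.Iidle j * (1 - P.satRatio j)

variable {P}

@[simp] theorem mem_higher {p : ℕ} {i : ι} : i ∈ P.higher p ↔ P.pH i < p := by simp [higher]

theorem higher_mono {p q : ℕ} (h : p ≤ q) : P.higher p ⊆ P.higher q := fun i hi => by
  rw [mem_higher] at hi ⊢
  omega

theorem rateAbove_nonneg (p : ℕ) : 0 ≤ P.rateAbove p := Finset.sum_nonneg fun i _ => P.r_nonneg i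

theorem rateAbove_mono {p q : ℕ} (h : p ≤ q) : P.rateAbove p ≤ P.rateAbove q :=
  Finset.sum_le_sum_of_subset_of_nonneg (higher_mono h) fun i _ _ => P.r_nonneg i

theorem idleBurst_nonneg (p : ℕ) : 0 ≤ P.idleBurst p := Finset.sum_nonneg fun i _ => by
  split_ifs with h
  · exact mul_nonneg (P.r_nonneg i) (P.betaIdle_nonneg h)
  · exact le_rfl

omit [Fintype ι] in
theorem maxMFSBelow_nonneg (p : ℕ) : 0 ≤ P.maxMFSBelow p := P.maxMFS_nonneg _

theorem mfs_le_maxMFSBelow {p : ℕ} {i : ι} (h : p ≤ P.pH i) : P.mfs i ≤ P.maxMFSBelow p :=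
  P.mfs_le_maxMFS (S := {i | p ≤ P.pL i}) (h.trans (P.pH_le_pL i))

/-- Sums over `P.higher (q + 1)`: there is at most one class of level `q`. -/
theorem sum_higher_succ (f : ι → ℝ) (q : ℕ) :
    (∑ i ∈ P.higher (q + 1), f i = ∑ i ∈ P.higher q, f i ∧ ∀ i, P.pH i ≠ q) ∨
      ∃ j, P.pH j = q ∧ ∑ i ∈ P.higher (q + 1), f i = f j + ∑ i ∈ P.higher q, f i := by
  classical
  by_cases h : ∃ j, P.pH j = q
  · obtain ⟨j, hj⟩ := h
    refine Or.inr ⟨j, hj, ?_⟩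
    have : P.higher (q + 1) = insert j (P.higher q) := by
      ext i
      rw [Finset.mem_insert, mem_higher, mem_higher, Nat.lt_succ_iff_lt_or_eq]
      constructor
      · rintro (hlt | heq)
        · exact Or.inr hlt
        · by_contra hne
          push Not at hne
          exact (P.level_ne i j hne.1).1 (heq.trans hj.symm)
      · rintro (rfl | hlt)
        · exact Or.inr hj
        · exact Or.inl hlt
    rw [this, Finset.sum_insert]
    rw [mem_higher, hj]
    exact lt_irrefl q
  · push Not at h
    refine Or.inl ⟨Finset.sum_congr ?_ fun _ _ => rfl, h⟩
    ext i
    rw [mem_higher, mem_higher, Nat.lt_succ_iff_lt_or_eq]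
    exact or_iff_left (h i)

theorem sum_higher_succ_of_eq (f : ι → ℝ) (j : ι) :
    ∑ i ∈ P.higher (P.pH j + 1), f i = f j + ∑ i ∈ P.higher (P.pH j), f i := by
  rcases sum_higher_succ (P := P) f (P.pH j) with ⟨_, h⟩ | ⟨i, hi, h⟩
  · exact absurd rfl (h j)
  · by_cases hij : i = j
    · rw [← hij] at h ⊢
      exact h
    · exact absurd hi (P.level_ne i j hij).1

theorem RateOK.r_le (hj : P.IsBLS j) (h : P.RateOK j) : P.r j ≤ P.Iidle j := by
  have h1 : 0 ≤ P.Iidle j / P.C * P.rateAbove (P.pH j) :=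
    mul_nonneg (div_pos (P.Iidle_pos hj) P.C_pos).le (rateAbove_nonneg _)
  have h2 := mul_nonneg (P.Iidle_pos hj).le (P.satRatio_nonneg hj)
  unfold RateOK at h
  linarith

theorem RateOK.satRatio_le_one (hj : P.IsBLS j) (h : P.RateOK j) : P.satRatio j ≤ 1 := by
  have h1 : 0 ≤ P.Iidle j / P.C * P.rateAbove (P.pH j) :=
    mul_nonneg (div_pos (P.Iidle_pos hj) P.C_pos).le (rateAbove_nonneg _)
  have h2 := P.r_nonneg j
  have h3 : 0 ≤ P.Iidle j * (1 - P.satRatio j) := by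
    unfold RateOK at h
    linarith
  linarith [nonneg_of_mul_nonneg_right h3 (P.Iidle_pos hj)]

end PortConfig

/-! ### Excess of a class and lower potential of the credit -/

namespace PortTrace

variable {ι : Type*} (P : PortConfig ι) (x : PortTrace ι)

/-- Excess over its burst of the traffic that class `i` may still have to send at time `t`:
backlog and unused part of the arrival curve. -/
noncomputable def excess (i : ι) (t : ℝ) : ℝ :=
  sInf ((fun u => x.arr i u + P.r i * (t - u)) '' Icc 0 t) - x.dep P i t

/-- Total excess of the classes whose high priority is above the level `p`. -/
noncomputable def excessAbove [Fintype ι] (p : ℕ) (t : ℝ) : ℝ :=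
  ∑ i ∈ P.higher p, x.excess P i t

/-- Service of class `j`, in which the service of `HC(j)` is counted with the weight `BW j`,
relative to its long-term guaranteed rate. -/
noncomputable def guaranteed [Fintype ι] (j : ι) (t : ℝ) : ℝ :=
  x.dep P j t + P.Iidle j / P.C * ∑ i ∈ P.higher (P.pH j), x.dep P i t
    - P.Iidle j * (1 - P.satRatio j) * t

open Classical in
/-- Potential of the credit of class `j`, to be compared with `guaranteed`. -/
noncomputable def creditFloor (j : ι) (t : ℝ) : ℝ :=
  if x.low P j t then
    (1 - P.satRatio j) * x.credit j t + P.satRatio j * P.LM j * P.C / P.Isend j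
  else x.credit j t * (1 + P.satRatio j * P.Iidle j / P.Isend j)

end PortTrace

/-! ### Evolution of the excess and service guaranteed by the credit -/

namespace IsExecution

variable {ι : Type*} {P : PortConfig ι} {x : PortTrace ι} (hx : IsExecution P x)
include hx

theorem bddBelow_envelope (i : ι) {t : ℝ} :
    BddBelow ((fun u => x.arr i u + P.r i * (t - u)) '' Icc 0 t) :=
  ⟨0, by
    rintro _ ⟨u, hu, rfl⟩
    exact add_nonneg (hx.arr_nonneg i u) (mul_nonneg (P.r_nonneg i) (sub_nonneg.2 hu.2))⟩

theorem excess_le_backlog (i : ι) {t : ℝ} (ht : 0 ≤ t) :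
    x.excess P i t ≤ x.arr i t - x.dep P i t := by
  have := csInf_le (hx.bddBelow_envelope i) ⟨t, ⟨ht, le_rfl⟩, rfl⟩
  simp only [sub_self, mul_zero, add_zero] at this
  unfold PortTrace.excess
  linarith

/-- The envelope of the input grows at rate at most `r i`, and the output is subtracted. -/
theorem excess_le_add (i : ι) {t t' : ℝ} (ht : 0 ≤ t) (htt : t ≤ t') :
    x.excess P i t' ≤ x.excess P i t + P.r i * (t' - t) - (x.dep P i t' - x.dep P i t) := by
  have : sInf ((fun u => x.arr i u + P.r i * (t' - u)) '' Icc 0 t') - P.r i * (t' - t) ≤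
      sInf ((fun u => x.arr i u + P.r i * (t - u)) '' Icc 0 t) := by
    refine le_csInf ⟨_, t, ⟨ht, le_rfl⟩, rfl⟩ ?_
    rintro _ ⟨u, hu, rfl⟩
    have := csInf_le (hx.bddBelow_envelope i) ⟨u, ⟨hu.1, hu.2.trans htt⟩, rfl⟩
    simp only at this ⊢
    linarith
  unfold PortTrace.excess
  linarith

theorem arr_le (i : ι) {u t : ℝ} (hu : 0 ≤ u) (hut : u ≤ t) :
    x.arr i t ≤ x.arr i u + P.alpha i (t - u) := by
  have h := hx.arr_curve i t (hu.trans hut)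
  have h2 : NetCalc.conv (x.arr i) (P.alpha i) t ≤
      ((x.arr i (t - (t - u)) + P.alpha i (t - u) : ℝ) : EReal) :=
    iInf₂_le (t - u) ⟨sub_nonneg.2 hut, by linarith⟩
  have h3 := EReal.coe_le_coe_iff.1 (h.trans h2)
  rwa [sub_sub_cancel] at h3

/-- The reason for introducing `excess`: it is what must be added to the arrival curve to bound the
output from an arbitrary instant, at which the class may be backlogged. -/
theorem dep_sub_le (i : ι) {s t : ℝ} (hs : 0 ≤ s) (hst : s ≤ t) :
    x.dep P i t - x.dep P i s ≤ P.alpha i (t - s) + x.excess P i s := by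
  have : x.dep P i t - P.b i - P.r i * (t - s) ≤
      sInf ((fun u => x.arr i u + P.r i * (s - u)) '' Icc 0 s) := by
    refine le_csInf ⟨_, s, ⟨hs, le_rfl⟩, rfl⟩ ?_
    rintro _ ⟨u, hu, rfl⟩
    have h1 := hx.arr_le i hu.1 (hu.2.trans hst)
    have h2 := hx.dep_le_arr i t
    simp only [PortConfig.alpha] at h1 ⊢
    linarith
  simp only [PortTrace.excess, PortConfig.alpha]
  linarith

theorem excessAbove_le_add [Fintype ι] (p : ℕ) {t t' : ℝ} (ht : 0 ≤ t) (htt : t ≤ t') :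
    x.excessAbove P p t' ≤ x.excessAbove P p t + P.rateAbove p * (t' - t) -
      (∑ i ∈ P.higher p, x.dep P i t' - ∑ i ∈ P.higher p, x.dep P i t) := by
  have := Finset.sum_le_sum fun i (_ : i ∈ P.higher p) => hx.excess_le_add i ht htt
  simp only [Finset.sum_add_distrib, Finset.sum_sub_distrib, ← Finset.sum_mul] at this
  exact this

/-- Class of a frame whose transmission starts while class `j` is backlogged. -/
theorem sender_class {j : ι} {a : ℝ} (ha : a ∈ x.starts) (hj : x.backlogged P j a) :
    x.cls a = j ∨ P.pH (x.cls a) < P.pH j ∨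
      (P.pH j < P.pH (x.cls a) ∧ x.low P j a ∧ P.pH (x.cls a) < P.pL j) := by
  by_cases hcls : x.cls a = j
  · exact Or.inl hcls
  obtain ⟨h1, h2, h3⟩ := P.level_ne _ _ hcls
  rcases lt_or_gt_of_ne h1 with hlt | hlt
  · exact Or.inr (Or.inl hlt)
  refine Or.inr (Or.inr ⟨hlt, ?_⟩)
  have hp := hx.priority a ha j hj
  have hge := prio_ge (P := P) (x := x) (x.cls a) a
  have hlow : x.low P j a := by
    by_contra hn
    rw [prio_of_not_low hn] at hp
    omega
  rw [prio_of_low hlow] at hp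
  exact ⟨hlow, by omega⟩

section Shaped

variable {j : ι} (hj : P.IsBLS j)
include hj

theorem credit_idle_of_pos {a b b' : ℝ} (ha : a ∈ x.starts) (hab : a ≤ b) (hbb : b ≤ b')
    (hba : b' ≤ a + x.len a / P.C) (hcls : x.cls a ≠ j)
    (hpos : ∀ τ ∈ Ico b b', 0 < x.credit j τ) :
    x.credit j b' = x.credit j b - P.Iidle j * (b' - b) := by
  have hb0 : 0 ≤ b := (hx.starts_nonneg a ha).trans hab
  refine le_antisymm ?_ (hx.credit_idle hj ha hab hbb hba hcls).2.1
  have := sub_le_mul_of_deriv_right_le (m := -P.Iidle j) hbb (hx.credit_contOn hj hb0)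
      (fun z hz => hx.credit_deriv j hj z (hb0.trans hz.1)) fun z hz => by
        rw [PortTrace.creditSlope, if_neg, if_pos (hpos z hz)]
        rintro ⟨a', ha', hcls'⟩
        exact hcls (hx.sending_unique ⟨ha, hab.trans hz.1, hz.2.trans_le hba⟩ ha' ▸ hcls')
  linarith

/-- Service of a shaped class as long as its credit does not vanish. -/
theorem dep_ge_of_credit_pos {u e : ℝ} (hue : u ≤ e)
    (busy : ∀ τ ∈ Ico u e, ∃ a, x.sending P a τ) (hpos : ∀ τ ∈ Ico u e, 0 < x.credit j τ) :
    P.Iidle j * (e - u) + x.credit j e - x.credit j u ≤ x.dep P j e - x.dep P j u := by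
  refine hx.busy_induction (p := fun τ =>
    P.Iidle j * (τ - u) + x.credit j τ - x.credit j u ≤ x.dep P j τ - x.dep P j u) hue busy
    (by simp) fun a b b' ha hub hbb hbe hab hba _ hp => ?_
  have key := hx.dep_sub_dep j ha hab hbb.le hba
  have hCSI := P.Isend_add_Iidle j
  split_ifs at key with hcls
  · have h1 := (hx.credit_send hj ha hab hbb.le hba hcls).2.1
    rw [← hCSI] at key
    linarith
  · have h1 := hx.credit_idle_of_pos hj ha hab hbb.le hba hcls fun τ hτ =>
      hpos τ ⟨hub.trans hτ.1, hτ.2.trans_le hbe⟩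
    linarith

theorem excess_le_of_credit_pos {u e : ℝ} (hu : 0 ≤ u) (hue : u ≤ e)
    (hcaught : x.arr j u ≤ x.dep P j u)
    (busy : ∀ τ ∈ Ico u e, ∃ a, x.sending P a τ) (hpos : ∀ τ ∈ Ico u e, 0 < x.credit j τ)
    (hr : P.r j ≤ P.Iidle j) :
    x.excess P j e ≤ P.r j * ((P.LM j - x.credit j e) / P.Iidle j) := by
  have hI := P.Iidle_pos hj
  have h1 := hx.excess_le_add j hu hue
  have h2 := hx.excess_le_backlog j hu
  have h3 := hx.dep_ge_of_credit_pos hj hue busy hpos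
  have h4 := hx.dep_mono j hue
  have h5 := hx.credit_le hj hu
  have hr0 := P.r_nonneg j
  set z := (P.LM j - x.credit j e) / P.Iidle j with hz
  have hzI : P.Iidle j * z = P.LM j - x.credit j e := by
    rw [hz]
    field_simp
  -- If the period is short, the growth `r j * (e - u)` suffices; if it is long, the service at rate
  -- `Iidle j ≥ r j` compensates for the surplus.
  rcases le_total (e - u) z with hle | hle
  · have := mul_le_mul_of_nonneg_left hle hr0
    linarith
  · have := mul_le_mul_of_nonneg_right hr (sub_nonneg.2 hle)
    linarith

variable [Fintype ι]

/-- The weights match the slopes: at high priority the rise of the credit under its own frames is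
that of `guaranteed`, and at low priority its fall under lower frames is. Frames of `HC(j)` raise
`guaranteed` while the credit falls. Saturation at `0` under a frame of `MC(j)` is paid for by the
constant of the low branch. -/
theorem creditFloor_step (hσ : P.satRatio j ≤ 1) {a b b' : ℝ} (ha : a ∈ x.starts) (hab : a ≤ b)
    (hbb : b ≤ b') (hba : b' ≤ a + x.len a / P.C)
    (hcls : x.cls a = j ∨ P.pH (x.cls a) < P.pH j ∨
      (P.pH j < P.pH (x.cls a) ∧ x.low P j b ∧ b' - b ≤ P.maxMFS (P.MC j) / P.C)) :
    x.creditFloor P j b' - x.creditFloor P j b ≤ x.guaranteed P j b' - x.guaranteed P j b := by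
  have hI := P.Iidle_pos hj
  have hS := P.Isend_pos hj
  have hC := P.C_pos
  have hCSI := P.Isend_add_Iidle j
  have hb0 : 0 ≤ b := (hx.starts_nonneg a ha).trans hab
  have hσ0 := P.satRatio_nonneg hj
  have hcM := hx.credit_le hj hb0
  have hcM' := hx.credit_le hj (hb0.trans hbb)
  have hid := P.satRatio_identity hj
  have hsat := P.Iidle_mul_maxMFS_le hj
  have key := hx.dep_sub_dep j ha hab hbb hba
  have keyS := hx.sum_dep_sub_dep (P.higher (P.pH j)) ha hab hbb hba
  set σ := P.satRatio j
  set c := x.credit j b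
  set c' := x.credit j b'
  set d := b' - b with hd
  have hd0 : 0 ≤ d := sub_nonneg.2 hbb
  have hG : x.guaranteed P j b' - x.guaranteed P j b = (x.dep P j b' - x.dep P j b) +
      P.Iidle j / P.C * (∑ i ∈ P.higher (P.pH j), x.dep P i b' -
        ∑ i ∈ P.higher (P.pH j), x.dep P i b) - P.Iidle j * (1 - σ) * d := by
    simp only [PortTrace.guaranteed, hd]
    ring
  -- Gap between the low and high branches at credit `z`: it vanishes at `LM`, so becoming low costs
  -- nothing, and is nonnegative below, so becoming high only lowers the potential.
  have hgap : ∀ z, (1 - σ) * z + σ * P.LM j * P.C / P.Isend j -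
      z * (1 + σ * P.Iidle j / P.Isend j) = σ * (P.LM j - z) * (P.C / P.Isend j) := by
    intro z
    rw [← hCSI]
    field_simp
    ring
  have hgap0 : 0 ≤ σ * (P.LM j - c') * (P.C / P.Isend j) :=
    mul_nonneg (mul_nonneg hσ0 (by linarith)) (div_pos hC hS).le
  have hgap' := hgap c'
  have hslope : 0 ≤ 1 + σ * P.Iidle j / P.Isend j :=
    add_nonneg zero_le_one (div_nonneg (mul_nonneg hσ0 hI.le) hS.le)
  rw [hG]
  by_cases hself : x.cls a = j
  · have hnot : x.cls a ∉ P.higher (P.pH j) := by simp [hself]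
    rw [if_pos hself] at key
    rw [if_neg hnot] at keyS
    rw [key, keyS]
    obtain ⟨_, h2, _⟩ := hx.credit_send hj ha hab hbb hba hself
    have hrise : P.C * d + P.Iidle j / P.C * 0 - P.Iidle j * (1 - σ) * d =
        P.Isend j * d * (1 + σ * P.Iidle j / P.Isend j) := by
      rw [← hCSI]
      field_simp
      ring
    rw [hrise]
    have hrise' : (c' - c) * (1 + σ * P.Iidle j / P.Isend j) ≤
        P.Isend j * d * (1 + σ * P.Iidle j / P.Isend j) :=
      mul_le_mul_of_nonneg_right (by linarith) hslope
    by_cases hl : x.low P j b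
    · have hl' := hx.low_send hj ha hab hbb hba hself hl
      simp only [PortTrace.creditFloor, if_pos hl, if_pos hl']
      have h3 : (1 - σ) * (c' - c) ≤ (1 - σ) * (P.Isend j * d) :=
        mul_le_mul_of_nonneg_left (by linarith) (by linarith)
      have h4 : 0 ≤ σ * (P.Isend j * d) := by positivity
      have h5 : 0 ≤ P.Isend j * d * (σ * P.Iidle j / P.Isend j) := by positivity
      linarith
    · by_cases hl' : x.low P j b'
      · have h3 : c' = P.LM j := hx.credit_eq_of_low_send hj ha hab hbb hba hself hl hl'
        simp only [PortTrace.creditFloor, if_neg hl, if_pos hl']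
        have h4 := hgap (P.LM j)
        rw [sub_self, mul_zero, zero_mul] at h4
        change (1 - σ) * c' + σ * P.LM j * P.C / P.Isend j -
          c * (1 + σ * P.Iidle j / P.Isend j) ≤ _
        rw [h3] at hrise' ⊢
        linarith
      · simp only [PortTrace.creditFloor, if_neg hl, if_neg hl']
        linarith
  · obtain ⟨h1, h2, h3⟩ := hx.credit_idle hj ha hab hbb hba hself
    rw [if_neg hself] at key
    have hmonoL : (1 - σ) * c' ≤ (1 - σ) * c := mul_le_mul_of_nonneg_left h1 (by linarith)
    rcases hcls with h | h | ⟨hlt, hl, hdM⟩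
    · exact absurd h hself
    · rw [if_pos (PortConfig.mem_higher.2 h)] at keyS
      rw [key, keyS]
      have hrise : 0 ≤ 0 + P.Iidle j / P.C * (P.C * d) - P.Iidle j * (1 - σ) * d := by
        have : 0 + P.Iidle j / P.C * (P.C * d) - P.Iidle j * (1 - σ) * d =
            P.Iidle j * σ * d := by
          field_simp
          ring
        rw [this]
        positivity
      refine le_trans ?_ hrise
      by_cases hl : x.low P j b
      · by_cases hl' : x.low P j b'
        · simp only [PortTrace.creditFloor, if_pos hl, if_pos hl']
          linarith
        · simp only [PortTrace.creditFloor, if_pos hl, if_neg hl']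
          linarith
      · have hl' := hx.not_low_idle hj ha hab hbb hba hself hl
        simp only [PortTrace.creditFloor, if_neg hl, if_neg hl']
        have := mul_le_mul_of_nonneg_right h1 hslope
        linarith
    · have hnot : x.cls a ∉ P.higher (P.pH j) := by
        rw [PortConfig.mem_higher]
        omega
      rw [if_neg hnot] at keyS
      rw [key, keyS]
      -- Either the credit ends at `0`, where `satRatio_identity` pays for the saturation, or it has
      -- fallen at full slope.
      rcases h3 with h3 | h3
      · have h3' : c' = 0 := h3
        have hl' : ¬ x.low P j b' := fun h => by
          have := LR_lt_credit_of_low h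
          linarith [P.LR_nonneg j hj]
        simp only [PortTrace.creditFloor, if_pos hl, if_neg hl']
        have h4 := LR_lt_credit_of_low hl
        have h5 : P.Iidle j * d ≤ P.Iidle j * (P.maxMFS (P.MC j) / P.C) :=
          mul_le_mul_of_nonneg_left hdM hI.le
        have h6 : (1 - σ) * (P.Iidle j * d) ≤ (1 - σ) * (c + P.Iidle j * P.mfsSat j / P.C) :=
          mul_le_mul_of_nonneg_left (by linarith) (by linarith)
        change c' * (1 + σ * P.Iidle j / P.Isend j) -
          ((1 - σ) * c + σ * P.LM j * P.C / P.Isend j) ≤ _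
        rw [h3']
        linarith
      · have h4 : (1 - σ) * c' = (1 - σ) * c - P.Iidle j * (1 - σ) * d := by
          have h3' : c' = c - P.Iidle j * d := h3
          rw [h3']
          ring
        by_cases hl' : x.low P j b'
        · simp only [PortTrace.creditFloor, if_pos hl, if_pos hl']
          linarith
        · simp only [PortTrace.creditFloor, if_pos hl, if_neg hl']
          linarith

/-- A frame started after `u` respects the priorities, since `j` is backlogged. Only the frame
already in flight at `e` may violate them, and `hfirst` rules this out. -/
theorem creditFloor_le_guaranteed (hσ : P.satRatio j ≤ 1) {u e a : ℝ} (hu : 0 ≤ u) (hue : u ≤ e)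
    (hea : e ≤ a) (hbl : ∀ τ ∈ Ioc u a, x.backlogged P j τ)
    (hfirst : ∀ b, x.sending P b e →
      x.cls b = j ∨ P.pH (x.cls b) < P.pH j ∨ b = e ∧ u < e) :
    x.creditFloor P j a - x.creditFloor P j e ≤ x.guaranteed P j a - x.guaranteed P j e := by
  have busy := hx.busy_of_backlogged (s := e) (t := a) (hu.trans hue)
    fun τ hτ => ⟨j, hbl τ ⟨hue.trans_lt hτ.1, hτ.2⟩⟩
  refine hx.busy_induction (p := fun τ =>
    x.creditFloor P j τ - x.creditFloor P j e ≤ x.guaranteed P j τ - x.guaranteed P j e)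
    hea busy (by simp) fun f b b' hf heb hbb hba hfb hbf hb hp => ?_
  have hstart : f = b → u < b → x.creditFloor P j b' - x.creditFloor P j b ≤
      x.guaranteed P j b' - x.guaranteed P j b := by
    rintro rfl hub
    refine hx.creditFloor_step hj hσ hf le_rfl hbb.le hbf ?_
    refine (hx.sender_class hf (hbl f ⟨hub, hbb.le.trans hba⟩)).imp_right
      (Or.imp_right fun ⟨h1, h2, h3⟩ => ⟨h1, h2, ?_⟩)
    have h4 : P.mfs (x.cls f) ≤ P.maxMFS (P.MC j) := P.mfs_le_maxMFS (Or.inl ⟨h1, h3⟩)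
    have h5 := div_le_div_of_nonneg_right ((hx.len_le f hf).trans h4) P.C_pos.le
    linarith
  suffices h : x.creditFloor P j b' - x.creditFloor P j b ≤
      x.guaranteed P j b' - x.guaranteed P j b by linarith
  rcases hb with rfl | ⟨rfl, hlt⟩
  · rcases hfirst f ⟨hf, hfb, by linarith⟩ with h | h | ⟨h, h'⟩
    · exact hx.creditFloor_step hj hσ hf hfb hbb.le hbf (Or.inl h)
    · exact hx.creditFloor_step hj hσ hf hfb hbb.le hbf (Or.inr (Or.inl h))
    · exact hstart h h'
  · exact hstart rfl (hue.trans_lt hlt)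

/-- Service of class `j` and of `HC(j)` from an instant at which the credit vanishes to the start
of a transmission at which class `j` has its low priority; `w` is the remaining duration of the
lower priority frame found at the beginning. -/
theorem service_from_zero_credit (hσ : P.satRatio j ≤ 1) {u e a : ℝ} (hu : 0 ≤ u) (hue : u ≤ e)
    (hea : e < a) (ha : a ∈ x.starts) (hbl : ∀ τ ∈ Ioc u a, x.backlogged P j τ)
    (hzero : x.credit j e = 0) (hlow : x.low P j a) :
    ∃ w, 0 ≤ w ∧ e + w ≤ a ∧
      (w = 0 ∨ ∃ b, x.sending P b e ∧ P.pH j ≤ P.pH (x.cls b) ∧ w = b + x.len b / P.C - e) ∧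
      P.Iidle j * (1 - P.satRatio j) *
          (a - e - w + P.mfsSat j / P.C + x.credit j a / P.Iidle j) ≤
        x.dep P j a - x.dep P j e + P.Iidle j / P.C *
          (∑ i ∈ P.higher (P.pH j), x.dep P i a - ∑ i ∈ P.higher (P.pH j), x.dep P i e) := by
  have hI := P.Iidle_pos hj
  have he0 := hu.trans hue
  have hnl : ∀ {t}, x.credit j t = 0 → ¬ x.low P j t := fun h h' => by
    have := LR_lt_credit_of_low h'
    linarith [P.LR_nonneg j hj]
  have hfa : x.creditFloor P j a = P.Iidle j * (1 - P.satRatio j) *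
      (P.mfsSat j / P.C + x.credit j a / P.Iidle j) := by
    rw [PortTrace.creditFloor, if_pos hlow, ← P.satRatio_identity hj]
    field_simp
    ring
  obtain ⟨b, hb⟩ := hx.busy_of_backlogged he0 (fun τ hτ => ⟨j, hbl τ ⟨hue.trans_lt hτ.1, hτ.2⟩⟩)
    e ⟨le_rfl, hea⟩
  by_cases hcls : x.cls b = j ∨ P.pH (x.cls b) < P.pH j
  · refine ⟨0, le_rfl, by linarith, Or.inl rfl, ?_⟩
    have key := hx.creditFloor_le_guaranteed hj hσ hu hue hea.le hbl fun b' hb' => by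
      rw [← hx.sending_unique hb hb']
      exact hcls.imp_right Or.inl
    have hfe : x.creditFloor P j e = 0 := by
      rw [PortTrace.creditFloor, if_neg (hnl hzero), hzero, zero_mul]
    rw [hfe, hfa] at key
    simp only [PortTrace.guaranteed] at key
    linarith
  -- A lower frame is in flight: the comparison starts at its end `e'`, where the credit is still
  -- `0`; the outputs before `e'` are only discarded.
  · push Not at hcls
    set e' := b + x.len b / P.C with he'
    have hee : e < e' := hb.2.2
    have hba : b < a := hb.2.1.trans_lt hea
    have hea' : e' ≤ a := hx.disjoint b hb.1 a ha hba
    have hid := hx.credit_idle hj hb.1 hb.2.1 hee.le le_rfl hcls.1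
    have hzero' : x.credit j e' = 0 :=
      le_antisymm (hid.1.trans hzero.le) (hx.credit_nonneg hj (he0.trans hee.le))
    refine ⟨e' - e, by linarith, by linarith, Or.inr ⟨b, hb, hcls.2, rfl⟩, ?_⟩
    have key := hx.creditFloor_le_guaranteed hj hσ hu (hue.trans hee.le) hea' hbl
      fun b' hb' => Or.inr (Or.inr ⟨by
        refine le_antisymm hb'.2.1 ?_
        rcases lt_trichotomy b b' with h | h | h
        · exact hx.disjoint b hb.1 b' hb'.1 h
        · rw [← h] at hb'
          exact absurd hb'.2.2 (lt_irrefl _)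
        · linarith [hx.disjoint b' hb'.1 b hb.1 h, hb'.2.2, hb.2.1], hue.trans_lt hee⟩)
    have hfe : x.creditFloor P j e' = 0 := by
      rw [PortTrace.creditFloor, if_neg (hnl hzero'), hzero', zero_mul]
    have h1 := hx.dep_mono j hee.le
    have h2 : ∑ i ∈ P.higher (P.pH j), x.dep P i e ≤ ∑ i ∈ P.higher (P.pH j), x.dep P i e' :=
      Finset.sum_le_sum fun i _ => hx.dep_mono i hee.le
    have h3 := mul_le_mul_of_nonneg_left h2 (div_pos hI P.C_pos).le
    rw [hfe, hfa] at key
    simp only [PortTrace.guaranteed] at key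
    linarith

end Shaped

end IsExecution

/-! ### Joint bound on the excess, by induction on the priority level -/

/-- Bound on the excess of the classes above the level `p`, at any time. -/
def ExcessBound {ι : Type*} [Fintype ι] (P : PortConfig ι) (x : PortTrace ι) (p : ℕ) : Prop :=
  ∀ t, 0 ≤ t →
    x.excessAbove P p t ≤ P.idleBurst p + P.rateAbove p * (P.maxMFSBelow p / P.C) ∧
      ∀ a, x.sending P a t → p ≤ P.pH (x.cls a) →
        x.excessAbove P p t + P.rateAbove p * (a + x.len a / P.C - t) ≤
          P.idleBurst p + P.rateAbove p * (P.maxMFSBelow p / P.C)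

namespace IsExecution

variable {ι : Type*} [Fintype ι] {P : PortConfig ι} {x : PortTrace ι} (hx : IsExecution P x)
include hx

/-- Excess of a backlogged shaped class at the start of a lower priority frame: either the credit
has not vanished in the current backlogged period, or the classes in `HC(j)` compensate. -/
theorem excess_shaped {j : ι} (hj : P.IsBLS j) (hr : P.RateOK j)
    (hE : ExcessBound P x (P.pH j)) {a : ℝ} (ha : a ∈ x.starts) (hlow : x.low P j a) :
    x.excess P j a ≤ P.r j * ((P.LM j - P.LR j) / P.Iidle j) ∨
      x.excess P j a + P.Iidle j / P.C * x.excessAbove P (P.pH j) a ≤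
        P.r j * ((P.LM j - P.LR j) / P.Iidle j + P.maxMFSBelow (P.pH j) / P.C) +
        P.Iidle j / P.C * (P.idleBurst (P.pH j) + P.rateAbove (P.pH j) *
          ((P.maxMFSBelow (P.pH j) - P.maxMFS (P.MC j)) / P.C)) := by
  have hI := P.Iidle_pos hj
  have hC := P.C_pos
  have hr0 := P.r_nonneg j
  have hR0 := PortConfig.rateAbove_nonneg (P := P) (P.pH j)
  have ha0 := hx.starts_nonneg a ha
  have hLR := LR_lt_credit_of_low hlow
  obtain ⟨u, ⟨hu0, hua⟩, hcu, hbu⟩ := exists_last_caught_up (hx.arr_left j) (hx.dep_mono j)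
    ((hx.arr_zero j 0 le_rfl).le.trans (hx.dep_nonneg j 0)) ha0
  have hbl' : ∀ τ ∈ Ioc u a, x.backlogged P j τ := fun τ hτ => sub_pos.2 (hbu τ hτ)
  have busy := hx.busy_of_backlogged hu0 fun τ hτ => ⟨j, hbl' τ hτ⟩
  -- Zeros of the credit in the current backlogged period of `j`; the first of them, if any,
  -- separates the two regimes.
  set S := Icc u a ∩ x.credit j ⁻¹' {0} with hS
  rcases S.eq_empty_or_nonempty with hempty | hne
  · left
    have hpos : ∀ τ ∈ Ico u a, 0 < x.credit j τ := fun τ hτ => by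
      refine lt_of_le_of_ne (hx.credit_nonneg hj (hu0.trans hτ.1)) fun h => ?_
      have : τ ∈ S := ⟨⟨hτ.1, hτ.2.le⟩, h.symm⟩
      simp [hempty] at this
    refine (hx.excess_le_of_credit_pos hj hu0 hua hcu busy hpos (hr.r_le hj)).trans ?_
    gcongr
  right
  have hcomp : IsCompact S := isCompact_Icc.of_isClosed_subset
    ((hx.credit_contOn hj hu0).preimage_isClosed_of_isClosed isClosed_Icc isClosed_singleton)
    inter_subset_left
  obtain ⟨e, ⟨⟨hue, hea⟩, hzero⟩, hmin⟩ := hcomp.exists_isLeast hne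
  replace hzero : x.credit j e = 0 := hzero
  have hpos : ∀ τ ∈ Ico u e, 0 < x.credit j τ := fun τ hτ => by
    refine lt_of_le_of_ne (hx.credit_nonneg hj (hu0.trans hτ.1)) fun h => ?_
    exact absurd (hmin ⟨⟨hτ.1, hτ.2.le.trans hea⟩, h.symm⟩) (not_le.2 hτ.2)
  have hea' : e < a := lt_of_le_of_ne hea fun h => by
    rw [h] at hzero
    linarith [P.LR_nonneg j hj]
  have he0 := hu0.trans hue
  have h1 := hx.excess_le_of_credit_pos hj hu0 hue hcu
    (fun τ hτ => busy τ ⟨hτ.1, hτ.2.trans_le hea⟩) hpos (hr.r_le hj)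
  rw [hzero, sub_zero] at h1
  obtain ⟨w, hw0, hwa, hw, hserv⟩ := hx.service_from_zero_credit hj (hr.satRatio_le_one hj) hu0 hue
    hea' ha hbl' hzero hlow
  have h2 := hx.excess_le_add j he0 hea
  have h3 := hx.excessAbove_le_add (P.pH j) he0 hea
  have h4 : x.excessAbove P (P.pH j) e + P.rateAbove (P.pH j) * w ≤ P.idleBurst (P.pH j) +
      P.rateAbove (P.pH j) * (P.maxMFSBelow (P.pH j) / P.C) := by
    rcases hw with rfl | ⟨b, hb, hbp, rfl⟩
    · rw [mul_zero, add_zero]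
      exact (hE e he0).1
    · exact (hE e he0).2 b hb hbp
  have h5 : w ≤ P.maxMFSBelow (P.pH j) / P.C := by
    rcases hw with rfl | ⟨b, hb, hbp, rfl⟩
    · exact div_nonneg (PortConfig.maxMFSBelow_nonneg _) hC.le
    · have := div_le_div_of_nonneg_right ((hx.len_le b hb.1).trans
        (PortConfig.mfs_le_maxMFSBelow hbp)) hC.le
      linarith [hb.2.1]
  have hsat := P.Iidle_mul_maxMFS_le hj
  set q := P.pH j
  set I := P.Iidle j
  set M := P.maxMFS (P.MC j)
  set L := P.maxMFSBelow q
  set rq := P.rateAbove q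
  set β := I / P.C with hβ
  have hβ0 : 0 ≤ β := (div_pos hI hC).le
  set v := P.mfsSat j / P.C with hv
  set z := x.credit j a / I with hz
  have hv0 : 0 ≤ v := div_nonneg (P.mfsSat_nonneg j) hC.le
  have hzLR : P.LR j / I ≤ z := div_le_div_of_nonneg_right hLR.le hI.le
  -- The class is still low at `a`, so its credit exceeds `LR`; this surplus and the saturation term
  -- together cover a frame of `MC(j)`.
  have hvz : M / P.C ≤ v + z := by
    have h6 : I * (M / P.C) ≤ I * (v + P.LR j / I) := by
      have : I * (v + P.LR j / I) = I * P.mfsSat j / P.C + P.LR j := by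
        rw [hv]
        field_simp
      rw [this]
      exact hsat
    linarith [le_of_mul_le_mul_left h6 hI]
  -- The weighted arrival rate of `j` and `HC(j)` is at most the guaranteed service rate: this is
  -- `RateOK`.
  have h7 : (P.r j + β * rq) * (a - e - w + v + z) ≤
      I * (1 - P.satRatio j) * (a - e - w + v + z) := by
    refine mul_le_mul_of_nonneg_right hr ?_
    have : 0 ≤ z := (div_nonneg (P.LR_nonneg j hj) hI.le).trans hzLR
    linarith
  have h8 : P.r j * (w - v - z) ≤ P.r j * (L / P.C - P.LR j / I) :=
    mul_le_mul_of_nonneg_left (by linarith) hr0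
  have h9 : β * (rq * (M / P.C)) ≤ β * (rq * (v + z)) := by gcongr
  have h10 := mul_le_mul_of_nonneg_left h3 hβ0
  have h11 := mul_le_mul_of_nonneg_left h4 hβ0
  have e1 : P.r j * ((P.LM j - P.LR j) / I + L / P.C) =
      P.r j * (P.LM j / I) + P.r j * (L / P.C - P.LR j / I) := by ring
  have e2 : β * (P.idleBurst q + rq * ((L - M) / P.C)) =
      β * (P.idleBurst q + rq * (L / P.C)) - β * (rq * (M / P.C)) := by ring
  rw [e1, e2]
  linarith

open Classical in
-- The classes are added one priority level at a time. A class without backlog has nonpositive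
-- excess. A backlogged one must be low, with the frame of `a` in `MC(j)`, so `excess_shaped`
-- applies. The term in `len a` leaves room for the growth of the excess during that frame.
theorem excessAbove_at_start {p : ℕ} (hr : ∀ j, P.IsBLS j → P.pH j < p → P.RateOK j)
    (hE : ∀ q < p, ExcessBound P x q) {a : ℝ} (ha : a ∈ x.starts) (hp : p ≤ P.pH (x.cls a)) :
    ∀ q ≤ p, x.excessAbove P q a ≤
      P.idleBurst q + P.rateAbove q * ((P.maxMFSBelow p - x.len a) / P.C) := by
  have hC := P.C_pos
  have ha0 := hx.starts_nonneg a ha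
  have hlen : x.len a ≤ P.maxMFSBelow p :=
    (hx.len_le a ha).trans (PortConfig.mfs_le_maxMFSBelow hp)
  have hΔ : 0 ≤ (P.maxMFSBelow p - x.len a) / P.C := div_nonneg (by linarith) hC.le
  intro q
  induction q with
  | zero => intro _; simp [PortTrace.excessAbove, PortConfig.idleBurst, PortConfig.rateAbove,
      PortConfig.higher]
  | succ q ih =>
    intro hq
    have hq' := ih (by omega)
    rcases PortConfig.sum_higher_succ (P := P) (fun _ => 0) q with ⟨_, hno⟩ | ⟨j, rfl, _⟩
    · have : P.higher (q + 1) = P.higher q := by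
        ext i
        rw [PortConfig.mem_higher, PortConfig.mem_higher]
        have := hno i
        omega
      simp only [PortTrace.excessAbove, PortConfig.idleBurst, PortConfig.rateAbove, this] at hq' ⊢
      exact hq'
    have e1 : x.excessAbove P (P.pH j + 1) a = x.excess P j a + x.excessAbove P (P.pH j) a :=
      PortConfig.sum_higher_succ_of_eq _ j
    have e2 : P.rateAbove (P.pH j + 1) = P.r j + P.rateAbove (P.pH j) :=
      PortConfig.sum_higher_succ_of_eq _ j
    have e3 := PortConfig.sum_higher_succ_of_eq (P := P)
      (fun i => open Classical in if P.IsBLS i then P.r i * P.betaIdle i else 0) j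
    change P.idleBurst (P.pH j + 1) = _ + P.idleBurst (P.pH j) at e3
    have hr0 := P.r_nonneg j
    rw [e1, e2, e3]
    have hstep : 0 ≤ P.r j * ((P.maxMFSBelow p - x.len a) / P.C) := mul_nonneg hr0 hΔ
    by_cases hbl : x.backlogged P j a
    · rcases hx.sender_class ha hbl with h | h | ⟨h1, hlow, h3⟩
      · rw [h] at hp
        omega
      · omega
      have hj : P.IsBLS j := hlow.1
      have hI := P.Iidle_pos hj
      rw [if_pos hj]
      have hlenM : x.len a ≤ P.maxMFS (P.MC j) :=
        (hx.len_le a ha).trans (P.mfs_le_maxMFS (Or.inl ⟨h1, h3⟩))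
      have hM0 : 0 ≤ P.maxMFS (P.MC j) / P.C := div_nonneg (P.maxMFS_nonneg _) hC.le
      have hidle : P.r j * P.betaIdle j = P.r j * ((P.LM j - P.LR j) / P.Iidle j) +
          P.r j * (P.maxMFS (P.MC j) / P.C) := by
        rw [PortConfig.betaIdle]
        ring
      have hrM := mul_nonneg hr0 hM0
      rcases hx.excess_shaped hj (hr j hj (by omega)) (hE _ (by omega)) ha hlow with h | h
      · rw [hidle]
        linarith
      -- A class that can be at or below level `pH j` is counted either in `maxMFSBelow p` or in
      -- `MC(j)`, and `len a` is at most both maxima.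
      have hL : P.maxMFSBelow (P.pH j) ≤ P.maxMFS (P.MC j) + P.maxMFSBelow p - x.len a := by
        refine P.maxMFS_le (by linarith [P.maxMFS_nonneg (P.MC j)]) fun i hi => ?_
        by_cases hip : p ≤ P.pL i
        · have : P.mfs i ≤ P.maxMFSBelow p := P.mfs_le_maxMFS (S := {i | p ≤ P.pL i}) hip
          linarith
        · have hij : j ≠ i := by
            rintro rfl
            omega
          have := P.level_ne j i hij
          have hi' : P.pH j ≤ P.pL i := hi
          have : P.mfs i ≤ P.maxMFS (P.MC j) := P.mfs_le_maxMFS (Or.inr ⟨by omega, by omega⟩)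
          linarith
      have hβ0 : 0 ≤ P.Iidle j / P.C := (div_pos hI hC).le
      have hβ1 : 0 ≤ 1 - P.Iidle j / P.C := by
        rw [sub_nonneg, div_le_one hC, ← P.Isend_add_Iidle j]
        linarith [P.Isend_pos hj]
      have hR0 := PortConfig.rateAbove_nonneg (P := P) (P.pH j)
      have h5 : (P.maxMFSBelow (P.pH j) - P.maxMFS (P.MC j)) / P.C ≤
          (P.maxMFSBelow p - x.len a) / P.C := div_le_div_of_nonneg_right (by linarith) hC.le
      have h6 := mul_le_mul_of_nonneg_left (mul_le_mul_of_nonneg_left h5 hR0) hβ0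
      -- The excess of `HC(j)` is split with weights `Iidle / C`, handled together with `j` by `h`,
      -- and `1 - Iidle / C`, handled by the bound of the previous level.
      have h7 := mul_le_mul_of_nonneg_left hq' hβ1
      have h8 : P.maxMFSBelow (P.pH j) / P.C ≤
          P.maxMFS (P.MC j) / P.C + (P.maxMFSBelow p - x.len a) / P.C := by
        rw [← add_div]
        exact div_le_div_of_nonneg_right (by linarith) hC.le
      have h9 := mul_le_mul_of_nonneg_left h8 hr0
      rw [hidle]
      linarith
    · have h1 := hx.excess_le_backlog (P := P) j ha0
      have h2 : x.arr j a - x.dep P j a ≤ 0 := not_lt.1 hbl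
      have h3 : 0 ≤ if P.IsBLS j then P.r j * P.betaIdle j else 0 := by
        split_ifs with h
        · exact mul_nonneg hr0 (P.betaIdle_nonneg h)
        · exact le_rfl
      linarith

/-- In a backlogged period of the higher classes the excess starts nonpositive. It does not increase
under their own frames, because their total rate is at most `C`; under a lower frame it is
controlled from the start of that frame. -/
theorem excessBound {p : ℕ} (hr : ∀ j, P.IsBLS j → P.pH j < p → P.RateOK j)
    (hC : P.rateAbove p ≤ P.C) : ExcessBound P x p := by
  induction p using Nat.strong_induction_on with
  | _ p ih =>
    have hE : ∀ q < p, ExcessBound P x q := fun q hq =>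
      ih q hq (fun j hj hjq => hr j hj (hjq.trans hq))
        ((PortConfig.rateAbove_mono hq.le).trans hC)
    have hC0 := P.C_pos
    have hR0 := PortConfig.rateAbove_nonneg (P := P) p
    have hsend : ∀ a t, a ∈ x.starts → a ≤ t → p ≤ P.pH (x.cls a) →
        x.excessAbove P p t + P.rateAbove p * (a + x.len a / P.C - t) ≤
          P.idleBurst p + P.rateAbove p * (P.maxMFSBelow p / P.C) := by
      intro a t ha hat hp
      have h1 := hx.excessAbove_at_start hr hE ha hp p le_rfl
      have h2 := hx.excessAbove_le_add (P := P) p (hx.starts_nonneg a ha) hat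
      have h3 : ∑ i ∈ P.higher p, x.dep P i a ≤ ∑ i ∈ P.higher p, x.dep P i t :=
        Finset.sum_le_sum fun i _ => hx.dep_mono i hat
      rw [sub_div, mul_sub] at h1
      linarith
    refine fun t ht => ⟨?_, fun a ha hp => hsend a t ha.1 ha.2.1 hp⟩
    obtain ⟨u, ⟨hu0, hut⟩, hcu, hbu⟩ := exists_last_caught_up
      (A := fun τ => ∑ i ∈ P.higher p, x.arr i τ) (D := fun τ => ∑ i ∈ P.higher p, x.dep P i τ)
      (fun τ => tendsto_finsetSum _ fun i _ => hx.arr_left i τ)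
      (fun _ _ h => Finset.sum_le_sum fun i _ => hx.dep_mono i h)
      (Finset.sum_le_sum fun i _ => (hx.arr_zero i 0 le_rfl).le.trans (hx.dep_nonneg i 0)) ht
    have busy := hx.busy_of_backlogged hu0 (t := t) fun τ hτ => by
      obtain ⟨i, _, hi⟩ := Finset.exists_lt_of_sum_lt (hbu τ hτ)
      exact ⟨i, sub_pos.2 hi⟩
    have hbase : x.excessAbove P p u ≤
        P.idleBurst p + P.rateAbove p * (P.maxMFSBelow p / P.C) := by
      have h1 : x.excessAbove P p u ≤ ∑ i ∈ P.higher p, (x.arr i u - x.dep P i u) :=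
        Finset.sum_le_sum fun i _ => hx.excess_le_backlog i hu0
      rw [Finset.sum_sub_distrib] at h1
      have h2 := mul_nonneg hR0 (div_nonneg (PortConfig.maxMFSBelow_nonneg (P := P) p) hC0.le)
      linarith [PortConfig.idleBurst_nonneg (P := P) p]
    refine hx.busy_induction (p := fun τ => x.excessAbove P p τ ≤
      P.idleBurst p + P.rateAbove p * (P.maxMFSBelow p / P.C)) hut busy hbase
      fun a b b' ha hub hbb _ hab hba _ hp => ?_
    by_cases hcls : p ≤ P.pH (x.cls a)
    · have h1 := hsend a b' ha (hab.trans hbb.le) hcls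
      have h2 : 0 ≤ P.rateAbove p * (a + x.len a / P.C - b') := mul_nonneg hR0 (by linarith)
      linarith
    · have h1 := hx.excessAbove_le_add (P := P) p (hu0.trans hub) hbb.le
      have h2 := hx.sum_dep_sub_dep (P.higher p) ha hab hbb.le hba
      rw [if_pos (PortConfig.mem_higher.2 (not_le.1 hcls))] at h2
      have h3 := mul_le_mul_of_nonneg_right hC (sub_nonneg.2 hbb.le)
      linarith

end IsExecution

/-! ### Positivity of the curves and lower bounds on the deconvolution -/

namespace PortConfig

variable {ι : Type*} {P : PortConfig ι} {j : ι}

theorem gammaIdle_pos (hj : P.IsBLS j) : 0 < P.gammaIdle j :=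
  div_pos (sub_pos.2 (P.LR_lt_LM j hj)) (P.Iidle_pos hj)

theorem gammaSend_pos (hj : P.IsBLS j) : 0 < P.gammaSend j :=
  add_pos_of_nonneg_of_pos (div_nonneg (P.mfs_nonneg j) P.C_pos.le)
    (div_pos (sub_pos.2 (P.LR_lt_LM j hj)) (P.Isend_pos hj))

theorem gammaInter_pos (hj : P.IsBLS j) : 0 < P.gammaInter j :=
  add_pos (P.gammaSend_pos hj) (P.gammaIdle_pos hj)

theorem burstMax_nonneg (hj : P.IsBLS j) : 0 ≤ P.burstMax j :=
  add_nonneg (mul_nonneg (div_pos P.C_pos (P.Isend_pos hj)).le (P.LM_pos hj).le) (P.mfs_nonneg j)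

theorem gammaBLS_nonneg (hj : P.IsBLS j) (k : ι) {t : ℝ} (ht : 0 ≤ t) : 0 ≤ P.gammaBLS j k t := by
  have h1 := P.gammaSend_pos hj
  have h2 := P.gammaIdle_pos hj
  have h3 := P.gammaInter_pos hj
  have h4 := P.burstMax_nonneg hj
  have h5 := P.C_pos
  unfold gammaBLS
  split_ifs <;> positivity

theorem alpha_nonneg (i : ι) {t : ℝ} (ht : 0 ≤ t) : 0 ≤ P.alpha i t :=
  add_nonneg (P.b_nonneg i) (mul_nonneg (P.r_nonneg i) ht)

variable [Fintype ι]

theorem rate_lt_of_not_rateOK (h : ¬ P.RateOK j) :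
    (P.C - ∑ h ∈ P.higher (P.pH j), P.r h - P.mfsSat j / P.betaInter j) * (P.Iidle j / P.C) <
      P.r j := by
  have hC := P.C_pos
  have e : (P.C - P.rateAbove (P.pH j) - P.mfsSat j / P.betaInter j) * (P.Iidle j / P.C) =
      P.Iidle j * (1 - P.satRatio j) - P.Iidle j / P.C * P.rateAbove (P.pH j) := by
    have : P.satRatio j = P.mfsSat j / P.betaInter j / P.C := by
      rw [satRatio, div_div, mul_comm]
    rw [this]
    field_simp
    ring
  unfold RateOK at h
  push Not at h
  change (P.C - P.rateAbove (P.pH j) - _) * _ < _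
  rw [e]
  linarith

theorem betaBLS_eq (t : ℝ) : P.betaBLS j t =
    (P.C - ∑ h ∈ P.higher (P.pH j), P.r h - P.mfsSat j / P.betaInter j) * (P.Iidle j / P.C) *
      max (t - P.betaIdle j) 0 := by
  unfold betaBLS
  congr 5
  ext i
  rw [mem_higher]
  simp only [Finset.mem_filter, Finset.mem_univ, true_and]
  exact Iff.rfl

/-- The supremum is bounded below by its term at the latency `betaIdle`, where `betaBLS` vanishes
whatever the sign of its slope. -/
theorem le_deconv (hj : P.IsBLS j) (t : ℝ) :
    ((P.alpha j (t + P.betaIdle j) : ℝ) : EReal) ≤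
      NetCalc.deconv (P.alpha j) (P.betaBLS j) t := by
  have h : P.betaBLS j (P.betaIdle j) = 0 := by
    rw [betaBLS_eq, sub_self, max_self, mul_zero]
  have := le_iSup₂ (f := fun s (_ : s ∈ Ici (0 : ℝ)) =>
    ((P.alpha j (t + s) - P.betaBLS j s : ℝ) : EReal)) (P.betaIdle j)
    (show P.betaIdle j ∈ Ici (0 : ℝ) from P.betaIdle_nonneg hj)
  rwa [h, sub_zero] at this

/-- The arrival curve is steeper than `betaBLS`, so the difference tends to infinity. -/
theorem deconv_eq_top (hj : P.IsBLS j) (h : ¬ P.RateOK j) (t : ℝ) :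
    NetCalc.deconv (P.alpha j) (P.betaBLS j) t = ⊤ := by
  rw [EReal.eq_top_iff_forall_lt]
  intro y
  have hK := rate_lt_of_not_rateOK h
  have hβ := fun s => P.betaBLS_eq (j := j) s
  set K := (P.C - ∑ h ∈ P.higher (P.pH j), P.r h - P.mfsSat j / P.betaInter j) *
    (P.Iidle j / P.C)
  set Δ := P.betaIdle j
  have hΔ : 0 ≤ Δ := P.betaIdle_nonneg hj
  -- The second argument solves the affine equation for the value `y + 1`; the maximum with `Δ`
  -- keeps `s` on the affine part of `betaBLS`.
  set s := max Δ ((y + 1 - P.b j - P.r j * t - K * Δ) / (P.r j - K)) with hs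
  have hsΔ : Δ ≤ s := le_max_left _ _
  have h1 : y + 1 - P.b j - P.r j * t - K * Δ ≤ s * (P.r j - K) :=
    (div_le_iff₀ (sub_pos.2 hK)).1 (le_max_right _ _)
  have h2 : y < P.alpha j (t + s) - P.betaBLS j s := by
    rw [hβ, max_eq_left (by linarith), alpha]
    linarith
  exact (EReal.coe_lt_coe_iff.2 h2).trans_le (le_iSup₂ (f := fun s (_ : s ∈ Ici (0 : ℝ)) =>
    ((P.alpha j (t + s) - P.betaBLS j s : ℝ) : EReal)) s (hΔ.trans hsΔ))

open Classical in
theorem sum_higher_eq (f : ι → ℝ) (p : ℕ) : ∑ i ∈ P.higher p, f i =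
    ∑ j with P.IsBLS j ∧ P.pH j < p, f j + ∑ j with ¬ P.IsBLS j ∧ P.pH j < p, f j := by
  rw [← Finset.sum_filter_add_sum_filter_not (P.higher p) P.IsBLS]
  congr 1
  · refine Finset.sum_congr ?_ fun _ _ => rfl
    ext i
    simp [and_comm]
  · refine Finset.sum_congr ?_ fun _ _ => rfl
    ext i
    simp [and_comm]

open Classical in
theorem sum_alpha_add_idleBurst (p : ℕ) (t : ℝ) :
    ∑ i ∈ P.higher p, P.alpha i t + P.idleBurst p =
      ∑ j with P.IsBLS j ∧ P.pH j < p, P.alpha j (t + P.betaIdle j) +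
        ∑ j with ¬ P.IsBLS j ∧ P.pH j < p, P.alpha j t := by
  rw [idleBurst, ← Finset.sum_add_distrib, sum_higher_eq]
  congr 1
  · refine Finset.sum_congr rfl fun i hi => ?_
    rw [Finset.mem_filter] at hi
    rw [if_pos hi.2.1]
    unfold alpha
    ring
  · refine Finset.sum_congr rfl fun i hi => ?_
    rw [Finset.mem_filter] at hi
    rw [if_neg hi.2.1, add_zero]

end PortConfig

/-! ### Maximum service of a shaped class -/

namespace PortTrace

variable {ι : Type*} (P : PortConfig ι) (x : PortTrace ι)

open Classical in
/-- Potential of the credit of class `j` that bounds its service from above. -/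
noncomputable def creditCeil (j : ι) (t : ℝ) : ℝ :=
  if x.low P j t then
    P.gammaIdle j * P.C / P.Isend j * P.LR j +
      P.C * P.gammaSend j / P.Iidle j * (x.credit j t - P.LR j)
  else P.gammaIdle j * P.C / P.Isend j * x.credit j t

end PortTrace

namespace IsExecution

variable {ι : Type*} {P : PortConfig ι} {x : PortTrace ι} (hx : IsExecution P x)
include hx

/-- Maximum service of a shaped class during a period in which none of its frames is started at
its low priority. -/
theorem dep_le_gamma {j : ι} (hj : P.IsBLS j) {u t : ℝ} (hu : 0 ≤ u) (hut : u ≤ t)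
    (busy : ∀ τ ∈ Ico u t, ∃ a, x.sending P a τ)
    (hblock : ∀ b ∈ x.starts, b ∈ Ioc u t → x.cls b = j → ¬ x.low P j b) :
    x.dep P j t - x.dep P j u ≤ P.gammaSend j / P.gammaInter j * P.C * (t - u) +
      P.burstMax j * (P.gammaIdle j / P.gammaInter j) := by
  have hI := P.Iidle_pos hj
  have hS := P.Isend_pos hj
  have hC := P.C_pos
  have hgI := P.gammaInter_pos hj
  have hgi := P.gammaIdle_pos hj
  have hgs := P.gammaSend_pos hj
  have hLM := P.LR_lt_LM j hj
  have hLR := P.LR_nonneg j hj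
  have hmfs := P.mfs_nonneg j
  have hinter : P.gammaInter j = P.gammaSend j + P.gammaIdle j := rfl
  -- The low slope of `creditCeil` (fall during idling) is at least its high slope (rise while
  -- sending), the difference being due to the frame time in `gammaSend`.
  have hcompare : P.gammaIdle j * P.C / P.Isend j ≤ P.C * P.gammaSend j / P.Iidle j := by
    rw [div_le_div_iff₀ hS hI]
    have h1 : P.gammaIdle j * P.Iidle j = P.LM j - P.LR j := by
      unfold PortConfig.gammaIdle
      field_simp
    have h2 : P.gammaSend j * P.Isend j = P.mfs j / P.C * P.Isend j + (P.LM j - P.LR j) := by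
      unfold PortConfig.gammaSend
      field_simp
    have h3 : 0 ≤ P.mfs j / P.C * P.Isend j := by positivity
    calc _ = P.C * (P.gammaIdle j * P.Iidle j) := by ring
      _ ≤ P.C * (P.gammaSend j * P.Isend j) := mul_le_mul_of_nonneg_left (by linarith) hC.le
      _ = _ := by ring
  -- The potential at `LM` on the low branch is the burst term; by `htop'` it exceeds the high
  -- branch by the cost of one whole frame, which pays for a transmission that goes on after the
  -- credit has reached `LM`.
  have htop : P.gammaIdle j * P.C / P.Isend j * P.LR j +
      P.C * P.gammaSend j / P.Iidle j * (P.LM j - P.LR j) = P.gammaIdle j * P.burstMax j := by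
    unfold PortConfig.gammaIdle PortConfig.gammaSend PortConfig.burstMax
    field_simp
    ring
  have htop' : P.gammaIdle j * P.burstMax j =
      P.gammaIdle j * P.C / P.Isend j * P.LM j + P.gammaIdle j * P.mfs j := by
    unfold PortConfig.burstMax
    ring
  have hAS : P.gammaIdle j * P.C / P.Isend j * P.Isend j = P.gammaIdle j * P.C := by field_simp
  have hBI : P.C * P.gammaSend j / P.Iidle j * P.Iidle j = P.C * P.gammaSend j := by field_simp
  have hA : 0 < P.gammaIdle j * P.C / P.Isend j := by positivity
  have hceil : ∀ τ, x.creditCeil P j τ = open Classical in if x.low P j τ then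
      P.gammaIdle j * P.C / P.Isend j * P.LR j +
      P.C * P.gammaSend j / P.Iidle j * (x.credit j τ - P.LR j)
      else P.gammaIdle j * P.C / P.Isend j * x.credit j τ := fun τ => rfl
  have hbase : 0 ≤ x.creditCeil P j u := by
    rw [hceil]
    split_ifs with hl
    · have h1 := LR_lt_credit_of_low hl
      have h2 : 0 ≤ x.credit j u - P.LR j := by linarith
      positivity
    · exact mul_nonneg hA.le (hx.credit_nonneg hj hu)
  set A := P.gammaIdle j * P.C / P.Isend j
  set B := P.C * P.gammaSend j / P.Iidle j
  have hB : 0 < B := hA.trans_le hcompare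
  suffices h : P.gammaInter j * (x.dep P j t - x.dep P j u) - P.gammaSend j * P.C * (t - u) ≤
      x.creditCeil P j t by
    have hle : x.creditCeil P j t ≤ P.gammaIdle j * P.burstMax j := by
      have h1 := hx.credit_le hj (hu.trans hut)
      rw [hceil]
      split_ifs
      · rw [← htop]
        gcongr
      · rw [htop']
        have := mul_le_mul_of_nonneg_left h1 hA.le
        have : 0 ≤ P.gammaIdle j * P.mfs j := by positivity
        linarith
    have e : P.gammaSend j / P.gammaInter j * P.C * (t - u) +
        P.burstMax j * (P.gammaIdle j / P.gammaInter j) =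
        (P.gammaSend j * P.C * (t - u) + P.gammaIdle j * P.burstMax j) / P.gammaInter j := by
      field_simp
    rw [e, le_div_iff₀ hgI]
    linarith
  refine hx.busy_induction (p := fun τ => P.gammaInter j * (x.dep P j τ - x.dep P j u) -
    P.gammaSend j * P.C * (τ - u) ≤ x.creditCeil P j τ) hut busy (by simpa using hbase)
    fun a b b' ha hub hbb hbt hab hba hb hp => ?_
  have hb0 : 0 ≤ b := hu.trans hub
  have key := hx.dep_sub_dep j ha hab hbb.le hba
  have hd : 0 < b' - b := sub_pos.2 hbb
  by_cases hcls : x.cls a = j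
  · rw [if_pos hcls] at key
    obtain ⟨h1, h2, h3⟩ := hx.credit_send hj ha hab hbb.le hba hcls
    have hmono : P.gammaInter j * (x.dep P j b' - x.dep P j u) - P.gammaSend j * P.C * (b' - u) =
        P.gammaInter j * (x.dep P j b - x.dep P j u) - P.gammaSend j * P.C * (b - u) +
          P.gammaIdle j * P.C * (b' - b) := by
      have : x.dep P j b' = x.dep P j b + P.C * (b' - b) := by linarith
      rw [this, hinter]
      ring
    have hsize : P.gammaIdle j * P.C * (b' - b) ≤ P.gammaIdle j * P.mfs j := by
      have h4 : P.C * (b' - b) ≤ P.mfs j := by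
        rw [← hcls]
        refine le_trans ?_ (hx.len_le a ha)
        rw [← le_div_iff₀' hC]
        linarith
      rw [mul_assoc]
      gcongr
    rw [hmono]
    by_cases hl : x.low P j b
    · have hl' := hx.low_send hj ha hab hbb.le hba hcls hl
      -- Sending while low is possible only for the frame in flight at `u`, when no output has been
      -- counted yet.
      rcases hb with rfl | ⟨rfl, hlt⟩
      · rw [hceil, if_pos hl']
        simp only [sub_self, mul_zero, zero_add]
        rcases h3 with h3 | h3
        · rw [h3, htop, htop']
          have : 0 < A * P.LM j := mul_pos hA (P.LM_pos hj)
          linarith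
        · rw [h3]
          have h4 : 0 ≤ B * (x.credit j b - P.LR j) :=
            mul_nonneg hB.le (sub_nonneg.2 (LR_lt_credit_of_low hl).le)
          have h5 : A * (P.Isend j * (b' - b)) ≤ B * (P.Isend j * (b' - b)) :=
            mul_le_mul_of_nonneg_right hcompare (by positivity)
          have h6 : A * (P.Isend j * (b' - b)) = P.gammaIdle j * P.C * (b' - b) := by
            rw [← hAS]
            ring
          have h7 : 0 ≤ A * P.LR j := by positivity
          linarith
      · exact absurd hl (hblock b ha ⟨hlt, hbb.le.trans hbt⟩ hcls)
    · rw [hceil, if_neg hl] at hp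
      by_cases hl' : x.low P j b'
      · rw [hceil, if_pos hl', hx.credit_eq_of_low_send hj ha hab hbb.le hba hcls hl hl', htop,
          htop']
        have := mul_le_mul_of_nonneg_left (hx.credit_le hj hb0) hA.le
        linarith
      · rw [hceil, if_neg hl']
        rcases h3 with h3 | h3
        · exact absurd (low_of_credit_eq hj (hb0.trans hbb.le) h3) hl'
        · rw [h3]
          have h6 : A * (P.Isend j * (b' - b)) = P.gammaIdle j * P.C * (b' - b) := by
            rw [← hAS]
            ring
          linarith
  · rw [if_neg hcls] at key
    obtain ⟨h1, h2, h3⟩ := hx.credit_idle hj ha hab hbb.le hba hcls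
    have hmono : P.gammaInter j * (x.dep P j b' - x.dep P j u) - P.gammaSend j * P.C * (b' - u) =
        P.gammaInter j * (x.dep P j b - x.dep P j u) - P.gammaSend j * P.C * (b - u) -
          B * (P.Iidle j * (b' - b)) := by
      have : x.dep P j b' = x.dep P j b := by linarith
      rw [this, ← mul_assoc, hBI]
      ring
    rw [hmono]
    by_cases hl : x.low P j b
    · rw [hceil, if_pos hl] at hp
      have h4 := mul_le_mul_of_nonneg_left h2 hB.le
      by_cases hl' : x.low P j b'
      · rw [hceil, if_pos hl']
        linarith
      · rw [hceil, if_neg hl']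
        have h5 := hx.credit_le_of_not_low_idle hj ha hab hbb.le hba hcls hl hl'
        have h6 := mul_le_mul_of_nonneg_right hcompare (sub_nonneg.2 h5)
        linarith
    · have hl' := hx.not_low_idle hj ha hab hbb.le hba hcls hl
      rw [hceil, if_neg hl] at hp
      rw [hceil, if_neg hl']
      have h4 := mul_le_mul_of_nonneg_left h2 hA.le
      have h5 : A * (P.Iidle j * (b' - b)) ≤ B * (P.Iidle j * (b' - b)) :=
        mul_le_mul_of_nonneg_right hcompare (by positivity)
      linarith

/-! ### Residual service of an unshaped class -/

variable [Fintype ι]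

omit hx in
theorem sum_univ_eq {f : ι → ℝ} {k : ι} [DecidableEq ι] :
    ∑ i, f i = ∑ i ∈ P.higher (P.pH k), f i + f k +
      ∑ i ∈ (P.higher (P.pH k))ᶜ.erase k, f i := by
  rw [← Finset.sum_add_sum_compl (P.higher (P.pH k)) f,
    ← Finset.add_sum_erase (P.higher (P.pH k))ᶜ f (a := k) (by simp), add_assoc]

theorem remaining_le {p : ℕ} {a t : ℝ} (h : x.sending P a t) (hp : p ≤ P.pH (x.cls a)) :
    P.C * (a + x.len a / P.C - t) ≤ P.maxMFSBelow p := by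
  have hC := P.C_pos
  have h1 : x.len a ≤ P.maxMFSBelow p :=
    (hx.len_le a h.1).trans (PortConfig.mfs_le_maxMFSBelow hp)
  have h2 : P.C * (a + x.len a / P.C - t) = x.len a - P.C * (t - a) := by
    field_simp
    ring
  have h3 : 0 ≤ P.C * (t - a) := mul_nonneg hC.le (sub_nonneg.2 h.2.1)
  linarith

omit [Fintype ι] in
/-- Class of a frame started while an unshaped class is backlogged. -/
theorem pH_cls_le {i : ι} (hi : ¬ P.IsBLS i) {a : ℝ} (ha : a ∈ x.starts)
    (hbl : x.backlogged P i a) : x.prio P (x.cls a) a ≤ P.pH i := by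
  have := hx.priority a ha i hbl
  rwa [prio_of_not_isBLS hi] at this

/-- Residual service of an unshaped class, the shaped classes being accounted for by their
arrivals. -/
theorem service_of_excess {k : ι} (hk : ¬ P.IsBLS k)
    (hr : ∀ j, P.IsBLS j → P.pH j < P.pH k → P.RateOK j) {s t : ℝ} (hs : 0 ≤ s) (hst : s ≤ t)
    (hbl : ∀ τ ∈ Ioc s t, x.backlogged P k τ) :
    P.C * (t - s) - (∑ i ∈ P.higher (P.pH k), P.alpha i (t - s) + P.idleBurst (P.pH k)) -
      P.maxMFSBelow (P.pH k) ≤ x.dep P k t - x.dep P k s := by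
  classical
  have hC := P.C_pos
  have hv : 0 ≤ t - s := sub_nonneg.2 hst
  have hL := PortConfig.maxMFSBelow_nonneg (P := P) (P.pH k)
  have hR := PortConfig.idleBurst_nonneg (P := P) (P.pH k)
  have hmono := hx.dep_mono k hst
  have hα : P.rateAbove (P.pH k) * (t - s) ≤ ∑ i ∈ P.higher (P.pH k), P.alpha i (t - s) := by
    rw [PortConfig.rateAbove, Finset.sum_mul]
    exact Finset.sum_le_sum fun i _ => le_add_of_nonneg_left (P.b_nonneg i)
  -- If the higher classes can saturate the link, the left-hand side is nonpositive.
  rcases le_or_gt P.C (P.rateAbove (P.pH k)) with hrC | hrC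
  · have := mul_le_mul_of_nonneg_right hrC hv
    linarith
  rcases hst.eq_or_lt with rfl | hlt
  · have := mul_nonneg (PortConfig.rateAbove_nonneg (P := P) (P.pH k)) hv
    simp only [sub_self, mul_zero] at *
    linarith
  have busy := hx.busy_of_backlogged hs fun τ hτ => ⟨k, hbl τ hτ⟩
  have htot := hx.sum_dep_of_busy hst busy
  rw [sum_univ_eq (P := P) (k := k), sum_univ_eq (P := P) (f := fun i => x.dep P i s) (k := k)]
    at htot
  have hhigh : ∑ i ∈ P.higher (P.pH k), x.dep P i t - ∑ i ∈ P.higher (P.pH k), x.dep P i s ≤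
      ∑ i ∈ P.higher (P.pH k), P.alpha i (t - s) + x.excessAbove P (P.pH k) s := by
    rw [← Finset.sum_sub_distrib, PortTrace.excessAbove, ← Finset.sum_add_distrib]
    exact Finset.sum_le_sum fun i _ => hx.dep_sub_le i hs hst
  obtain ⟨hE1, hE2⟩ := hx.excessBound hr hrC.le s hs
  obtain ⟨a, ha⟩ := busy s ⟨le_rfl, hlt⟩
  obtain ⟨hres0, hres⟩ := hx.sum_dep_residual (S := (P.higher (P.pH k))ᶜ.erase k) hlt busy ha
    fun b hb hbst hmem => by
      rw [Finset.mem_erase, Finset.mem_compl, PortConfig.mem_higher] at hmem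
      have h1 := hx.pH_cls_le hk hb (hbl b hbst)
      have h2 := prio_ge (P := P) (x := x) (x.cls b) b
      have h3 := P.level_ne _ _ hmem.1
      omega
  -- A lower frame with remaining time `w` takes `C w` of service but lowers the bound on the excess
  -- by `rateAbove * w`. As `rateAbove < C`, the worst case is a full frame, and the total cost
  -- never exceeds one maximal frame.
  have hsplit : P.rateAbove (P.pH k) * (P.maxMFSBelow (P.pH k) / P.C) ≤
      P.maxMFSBelow (P.pH k) := by
    have := mul_le_mul_of_nonneg_right hrC.le (div_nonneg hL hC.le)
    rwa [mul_div_cancel₀ _ hC.ne'] at this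
  by_cases hmem : x.cls a ∈ (P.higher (P.pH k))ᶜ.erase k
  · have hp : P.pH k ≤ P.pH (x.cls a) := by
      rw [Finset.mem_erase, Finset.mem_compl, PortConfig.mem_higher] at hmem
      exact not_lt.1 hmem.2
    have h1 := hE2 a ha hp
    have h2 := hx.remaining_le ha hp
    have h3 := mul_le_mul_of_nonneg_left (min_le_right t (a + x.len a / P.C)) hC.le
    have h4 : a + x.len a / P.C - s ≤ P.maxMFSBelow (P.pH k) / P.C := by
      rwa [le_div_iff₀' hC]
    have h5 := mul_le_mul_of_nonneg_left h4 (sub_nonneg.2 hrC.le)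
    have h6 : (P.C - P.rateAbove (P.pH k)) * (P.maxMFSBelow (P.pH k) / P.C) =
        P.maxMFSBelow (P.pH k) -
          P.rateAbove (P.pH k) * (P.maxMFSBelow (P.pH k) / P.C) := by
      field_simp
    linarith
  · have := hres0 hmem
    linarith

open Classical in
/-- Residual service of an unshaped class, the shaped classes being accounted for by their maximum
service. -/
theorem service_of_gamma {k : ι} (hk : ¬ P.IsBLS k) {s t : ℝ} (hs : 0 ≤ s) (hst : s ≤ t)
    (hbl : ∀ τ ∈ Ioc s t, x.backlogged P k τ) :
    P.C * (t - s) - ∑ j with P.IsBLS j ∧ P.pH j < P.pH k, P.gammaBLS j k (t - s) -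
      ∑ j with ¬ P.IsBLS j ∧ P.pH j < P.pH k, P.alpha j (t - s) - P.maxMFSBelow (P.pH k) ≤
        x.dep P k t - x.dep P k s := by
  have hC := P.C_pos
  have hv : 0 ≤ t - s := sub_nonneg.2 hst
  have hL := PortConfig.maxMFSBelow_nonneg (P := P) (P.pH k)
  have hmono := hx.dep_mono k hst
  set BL : Finset ι := Finset.univ.filter fun j => P.IsBLS j ∧ P.pH j < P.pH k with hBL
  set NB : Finset ι := Finset.univ.filter fun j => ¬ P.IsBLS j ∧ P.pH j < P.pH k with hNB
  by_cases hMC : ∀ j ∈ BL, k ∈ P.MC j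
  swap
  · push Not at hMC
    obtain ⟨j, hj, hjk⟩ := hMC
    have h1 : P.gammaBLS j k (t - s) ≤ ∑ j ∈ BL, P.gammaBLS j k (t - s) :=
      Finset.single_le_sum (f := fun j => P.gammaBLS j k (t - s))
        (fun i hi => P.gammaBLS_nonneg (Finset.mem_filter.1 hi).2.1 k hv) hj
    rw [PortConfig.gammaBLS, if_neg hjk] at h1
    have h2 : 0 ≤ ∑ j ∈ NB, P.alpha j (t - s) :=
      Finset.sum_nonneg fun i _ => P.alpha_nonneg i hv
    linarith
  -- The arrival curves bound the output of the unshaped higher classes only from an instant at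
  -- which they have no backlog.
  obtain ⟨u, ⟨hu0, hus⟩, hcu, hbu⟩ := exists_last_caught_up
    (A := fun τ => ∑ i ∈ NB, x.arr i τ) (D := fun τ => ∑ i ∈ NB, x.dep P i τ)
    (fun τ => tendsto_finsetSum _ fun i _ => hx.arr_left i τ)
    (fun _ _ h => Finset.sum_le_sum fun i _ => hx.dep_mono i h)
    (Finset.sum_le_sum fun i _ => (hx.arr_zero i 0 le_rfl).le.trans (hx.dep_nonneg i 0)) hs
  have hut := hus.trans hst
  have hblN : ∀ τ ∈ Ioc u s, ∃ i, ¬ P.IsBLS i ∧ P.pH i < P.pH k ∧ x.backlogged P i τ := by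
    intro τ hτ
    obtain ⟨i, hi, hlt⟩ := Finset.exists_lt_of_sum_lt (hbu τ hτ)
    exact ⟨i, (Finset.mem_filter.1 hi).2.1, (Finset.mem_filter.1 hi).2.2, sub_pos.2 hlt⟩
  have busy : ∀ τ ∈ Ico u t, ∃ a, x.sending P a τ := hx.busy_of_backlogged hu0 fun τ hτ => by
    rcases le_or_gt τ s with h | h
    · obtain ⟨i, _, _, hi⟩ := hblN τ ⟨hτ.1, h⟩
      exact ⟨i, hi⟩
    · exact ⟨k, hbl τ ⟨h, hτ.2⟩⟩
  have hprioN : ∀ b ∈ x.starts, b ∈ Ioc u s → x.prio P (x.cls b) b < P.pH k := by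
    intro b hb hbus
    obtain ⟨i, hi, hik, hbi⟩ := hblN b hbus
    exact (hx.pH_cls_le hi hb hbi).trans_lt hik
  have hprio : ∀ b ∈ x.starts, b ∈ Ioc u t → x.prio P (x.cls b) b ≤ P.pH k := by
    intro b hb hbut
    rcases le_or_gt b s with h | h
    · exact (hprioN b hb ⟨hbut.1, h⟩).le
    · exact hx.pH_cls_le hk hb (hbl b ⟨h, hbut.2⟩)
  -- As `k` has a single priority, membership in `MC(j)` places it strictly above the low level of
  -- `j`: low frames of `j` are blocked throughout `]u, t]`.
  have hMC' : ∀ j ∈ BL, P.pH k < P.pL j := fun j hj => by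
    rcases hMC j hj with h | h
    · exact h.2
    · have : P.pH k = P.pL k := le_antisymm (P.pH_le_pL k) (not_lt.1 hk)
      omega
  have hBLdep : ∑ j ∈ BL, x.dep P j t - ∑ j ∈ BL, x.dep P j u ≤
      ∑ j ∈ BL, (P.gammaSend j / P.gammaInter j * P.C * (t - u) +
        P.burstMax j * (P.gammaIdle j / P.gammaInter j)) := by
    rw [← Finset.sum_sub_distrib]
    refine Finset.sum_le_sum fun j hj => ?_
    refine hx.dep_le_gamma (Finset.mem_filter.1 hj).2.1 hu0 hut busy fun b hb hbut hcls hl => ?_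
    have h1 := hprio b hb hbut
    rw [hcls, prio_of_low hl] at h1
    exact absurd (hMC' j hj) (not_lt.2 h1)
  have hNBdep : ∑ j ∈ NB, x.dep P j t - ∑ j ∈ NB, x.dep P j u ≤
      ∑ j ∈ NB, P.alpha j (t - u) := by
    have h1 : ∑ j ∈ NB, x.dep P j t ≤ ∑ j ∈ NB, (x.arr j u + P.alpha j (t - u)) :=
      Finset.sum_le_sum fun i _ => (hx.dep_le_arr i t).trans (hx.arr_le i hu0 hut)
    rw [Finset.sum_add_distrib] at h1
    linarith
  have hhigh : ∀ τ, ∑ i ∈ P.higher (P.pH k), x.dep P i τ =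
      ∑ j ∈ BL, x.dep P j τ + ∑ j ∈ NB, x.dep P j τ := fun τ => PortConfig.sum_higher_eq _ _
  have htot := hx.sum_dep_of_busy hut busy
  -- Over both parts of the period only the frame in flight at `u` can belong to these classes, so a
  -- single frame is charged; `k` itself is counted on `[u, s]` and left out on `[s, t]`.
  have hlower : ∑ i ∈ (P.higher (P.pH k))ᶜ, x.dep P i s -
      ∑ i ∈ (P.higher (P.pH k))ᶜ, x.dep P i u +
      (∑ i ∈ (P.higher (P.pH k))ᶜ.erase k, x.dep P i t -
        ∑ i ∈ (P.higher (P.pH k))ᶜ.erase k, x.dep P i s) ≤ P.maxMFSBelow (P.pH k) := by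
    have hmemH : ∀ i, i ∈ (P.higher (P.pH k))ᶜ ↔ P.pH k ≤ P.pH i := fun i => by
      rw [Finset.mem_compl, PortConfig.mem_higher, not_lt]
    have hnoN : ∀ b ∈ x.starts, b ∈ Ioc u s → x.cls b ∉ (P.higher (P.pH k))ᶜ := by
      intro b hb hbus
      rw [hmemH, not_le]
      exact (prio_ge _ _).trans_lt (hprioN b hb hbus)
    have hno : ∀ b ∈ x.starts, b ∈ Ioc s t → x.cls b ∉ (P.higher (P.pH k))ᶜ.erase k := by
      intro b hb hbst hmem
      rw [Finset.mem_erase, hmemH] at hmem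
      have h1 := hprio b hb ⟨hus.trans_lt hbst.1, hbst.2⟩
      have h2 := prio_ge (P := P) (x := x) (x.cls b) b
      have h3 := P.level_ne _ _ hmem.1
      omega
    have hfirst : ∑ i ∈ (P.higher (P.pH k))ᶜ, x.dep P i s -
        ∑ i ∈ (P.higher (P.pH k))ᶜ, x.dep P i u ≤ P.maxMFSBelow (P.pH k) := by
      rcases hus.eq_or_lt with rfl | hlt
      · rwa [sub_self]
      obtain ⟨a, ha⟩ := busy u ⟨le_rfl, hlt.trans_le hst⟩
      obtain ⟨h0, h1⟩ := hx.sum_dep_residual hlt (fun τ hτ => busy τ ⟨hτ.1, hτ.2.trans_le hst⟩)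
        ha hnoN
      by_cases hmem : x.cls a ∈ (P.higher (P.pH k))ᶜ
      · have h2 := hx.remaining_le ha ((hmemH _).1 hmem)
        have h3 := mul_le_mul_of_nonneg_left (min_le_right s (a + x.len a / P.C)) hC.le
        linarith
      · linarith [h0 hmem]
    rcases hst.eq_or_lt with rfl | hlt
    · linarith
    obtain ⟨a, ha⟩ := busy s ⟨hus, hlt⟩
    obtain ⟨h0, h1⟩ := hx.sum_dep_residual hlt (fun τ hτ => busy τ ⟨hus.trans hτ.1, hτ.2⟩)
      ha hno
    by_cases hmem : x.cls a ∈ (P.higher (P.pH k))ᶜ.erase k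
    · have hmem' := Finset.mem_of_mem_erase hmem
      -- A lower frame still in flight at `s` was already in flight at `u`; its two portions add up
      -- to at most one frame.
      have hau : a ≤ u := by
        by_contra hcon
        exact hnoN a ha.1 ⟨not_le.1 hcon, ha.2.1⟩ hmem'
      have hau' : x.sending P a u := ⟨ha.1, hau, hus.trans_lt ha.2.2⟩
      have h2 := hx.remaining_le hau' ((hmemH _).1 hmem')
      have h3 := mul_le_mul_of_nonneg_left (min_le_right t (a + x.len a / P.C)) hC.le
      rcases hus.eq_or_lt with rfl | hlt'
      · linarith
      obtain ⟨_, h4⟩ := hx.sum_dep_residual hlt'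
        (fun τ hτ => busy τ ⟨hτ.1, hτ.2.trans_le hst⟩) hau' hnoN
      have h5 := mul_le_mul_of_nonneg_left (min_le_left s (a + x.len a / P.C)) hC.le
      linarith
    · linarith [h0 hmem]
  have hsvc : P.C * (t - u) - ∑ j ∈ BL, (P.gammaSend j / P.gammaInter j * P.C * (t - u) +
      P.burstMax j * (P.gammaIdle j / P.gammaInter j)) - ∑ j ∈ NB, P.alpha j (t - u) -
      P.maxMFSBelow (P.pH k) ≤ x.dep P k t - x.dep P k s := by
    have hs1 := Finset.sum_add_sum_compl (P.higher (P.pH k)) fun i => x.dep P i u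
    have hs2 := Finset.sum_add_sum_compl (P.higher (P.pH k)) fun i => x.dep P i s
    have hs3 := sum_univ_eq (P := P) (f := fun i => x.dep P i s) (k := k)
    have hs4 := sum_univ_eq (P := P) (f := fun i => x.dep P i t) (k := k)
    have hh1 := hhigh u
    have hh2 := hhigh t
    linarith
  have hγ : ∑ j ∈ BL, P.gammaBLS j k (t - s) = ∑ j ∈ BL,
      (P.gammaSend j / P.gammaInter j * P.C * (t - s) +
        P.burstMax j * (P.gammaIdle j / P.gammaInter j)) :=
    Finset.sum_congr rfl fun j hj => if_pos (hMC j hj)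
  rw [hγ]
  have hburst : 0 ≤ ∑ j ∈ BL, P.burstMax j * (P.gammaIdle j / P.gammaInter j) :=
    Finset.sum_nonneg fun j hj => by
      have hj' := (Finset.mem_filter.1 hj).2.1
      exact mul_nonneg (P.burstMax_nonneg hj')
        (div_pos (P.gammaIdle_pos hj') (P.gammaInter_pos hj')).le
  have hb : 0 ≤ ∑ j ∈ NB, P.b j := Finset.sum_nonneg fun j _ => P.b_nonneg j
  simp only [PortConfig.alpha, Finset.sum_add_distrib, ← Finset.sum_mul] at hsvc ⊢
  set g := (∑ j ∈ BL, P.gammaSend j / P.gammaInter j) * P.C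
  set r := ∑ j ∈ NB, P.r j
  -- If the bound is nondecreasing in the duration, `t - s ≤ t - u` suffices; otherwise its value at
  -- `t - s` is nonpositive.
  rcases le_total 0 (P.C - g - r) with hslope | hslope
  · have := mul_le_mul_of_nonneg_left (show t - s ≤ t - u by linarith) hslope
    linarith
  · have := mul_nonpos_of_nonpos_of_nonneg hslope hv
    linarith

end IsExecution

/-! ### Assembly of the two curves -/

theorem theorem7 {ι : Type*} [Fintype ι] (P : PortConfig ι) (x : PortTrace ι)
    (hx : IsExecution P x)
    (β : ℝ → ℝ)
    (hβ : NetCalc.IsStrictServiceCurve (fun t => ∑ i, x.arr i t) (fun t => ∑ i, x.dep P i t)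
      (fun t => (β t : EReal)))
    (k : ι) (hk : ¬ P.IsBLS k) :
    NetCalc.IsStrictServiceCurve (x.arr k) (x.dep P k)
      (fun t => max (P.betaSPcurve β k t) (P.betaBLScurve β k t)) := by
  classical
  intro s t hs hst hbl
  have hmono : ((0 : ℝ) : EReal) ≤ ((x.dep P k t - x.dep P k s : ℝ) : EReal) :=
    EReal.coe_le_coe_iff.2 (sub_nonneg.2 (hx.dep_mono k hst))
  -- The aggregate is backlogged with `k`, and its output over `[s, s + v]` is exactly `C v`.
  have hβC : ∀ v ∈ Icc (0 : ℝ) (t - s), β v ≤ P.C * v := by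
    intro v hv
    have hbl' : ∀ τ ∈ Ioc s (s + v), x.backlogged P k τ := fun τ hτ =>
      hbl τ ⟨hτ.1, by linarith [hτ.2, hv.2]⟩
    have h1 := hβ s (s + v) hs (by linarith [hv.1]) fun τ hτ => by
      rw [← Finset.sum_sub_distrib]
      exact Finset.sum_pos' (fun i _ => sub_nonneg.2 (hx.dep_le_arr i τ))
        ⟨k, Finset.mem_univ k, hbl' τ hτ⟩
    rw [add_sub_cancel_left, EReal.coe_le_coe_iff] at h1
    have h2 := hx.sum_dep_of_busy (s := s) (t := s + v) (by linarith [hv.1])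
      (hx.busy_of_backlogged hs fun τ hτ => ⟨k, hbl' τ hτ⟩)
    rw [add_sub_cancel_left] at h2
    exact h1.trans h2.le
  have hsub : ∀ v ∈ Icc (0 : ℝ) (t - s), ∀ τ ∈ Ioc s (s + v), x.backlogged P k τ :=
    fun v hv τ hτ => hbl τ ⟨hτ.1, by linarith [hτ.2, hv.2]⟩
  have hend : ∀ v ∈ Icc (0 : ℝ) (t - s), x.dep P k (s + v) ≤ x.dep P k t :=
    fun v hv => hx.dep_mono k (by linarith [hv.2])
  refine max_le (max_le hmono (iSup₂_le fun v hv => ?_)) (max_le hmono (iSup₂_le fun v hv => ?_))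
  · by_cases hr : ∀ j, P.IsBLS j → P.pH j < P.pH k → P.RateOK j
    · have h1 := hx.service_of_excess hk hr hs (t := s + v) (by linarith [hv.1]) (hsub v hv)
      rw [add_sub_cancel_left, PortConfig.sum_alpha_add_idleBurst] at h1
      have h2 : ((∑ j with P.IsBLS j ∧ P.pH j < P.pH k, P.alpha j (v + P.betaIdle j) : ℝ) : EReal)
          ≤ ∑ j with P.IsBLS j ∧ P.pH j < P.pH k,
            NetCalc.deconv (P.alpha j) (P.betaBLS j) v := by
        have hcoe : ∀ (S : Finset ι) (f : ι → ℝ),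
            ((∑ j ∈ S, f j : ℝ) : EReal) = ∑ j ∈ S, (f j : EReal) := fun S f =>
          map_sum (⟨⟨Real.toEReal, EReal.coe_zero⟩, EReal.coe_add⟩ : ℝ →+ EReal) f S
        rw [hcoe]
        exact Finset.sum_le_sum fun j hj => P.le_deconv (Finset.mem_filter.1 hj).2.1 v
      refine (EReal.sub_le_sub (EReal.sub_le_sub (EReal.sub_le_sub le_rfl h2) le_rfl)
        le_rfl).trans ?_
      rw [← EReal.coe_sub, ← EReal.coe_sub, ← EReal.coe_sub, EReal.coe_le_coe_iff]
      have h3 := hβC v hv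
      have h4 := hend v hv
      have h5 : P.maxMFSBelow (P.pH k) = P.maxMFS (P.notHigher k) := rfl
      linarith
    -- One infinite deconvolution makes the sum `⊤`, because the other terms are nonnegative, and
    -- the residual is then `⊥`.
    · push Not at hr
      obtain ⟨j, hj, hjk, hjr⟩ := hr
      have h1 : ∑ j with P.IsBLS j ∧ P.pH j < P.pH k,
          NetCalc.deconv (P.alpha j) (P.betaBLS j) v = ⊤ := by
        refine top_le_iff.1 ?_
        rw [← PortConfig.deconv_eq_top hj hjr v]
        refine Finset.single_le_sum (f := fun j => NetCalc.deconv (P.alpha j) (P.betaBLS j) v)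
          (fun i hi => ?_) (Finset.mem_filter.2 ⟨Finset.mem_univ j, hj, hjk⟩)
        have hi' := (Finset.mem_filter.1 hi).2.1
        exact (EReal.coe_nonneg.2 (P.alpha_nonneg i
          (add_nonneg hv.1 (P.betaIdle_nonneg hi')))).trans (P.le_deconv hi' v)
      simp only
      rw [h1, EReal.sub_top, EReal.bot_sub, EReal.bot_sub]
      exact bot_le
  · have h1 := hx.service_of_gamma hk hs (t := s + v) (by linarith [hv.1]) (hsub v hv)
    rw [add_sub_cancel_left] at h1
    rw [EReal.coe_le_coe_iff]
    have h3 := hβC v hv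
    have h4 := hend v hv
    have h5 : P.maxMFSBelow (P.pH k) = P.maxMFS (P.notHigher k) := rfl
    rw [← h5]
    refine le_trans ?_ (h1.trans (by linarith))
    gcongr
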